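/- **Setting.** Let $\Omega\subset\mathbb{R}^d$ be open and bounded, $X=(0,1)\times\overline\Omega$, and $\alpha,\beta>0$. *Measures and curves.* $\mathcal M(\cdot)$ denotes bounded signed (or $\mathbb R^d$-valued) Borel measures, and $\mathcal M=\mathcal M(X)\times\mathcal M(X;\mathbb R^d)$. Let $H^1=H^1([0,1];\mathbb{R}^d)$, identified with the absolutely continuous curves with square integrable derivative, and $H^1_\Omega=\{\gamma\in H^1:\gamma([0,1])\subset\overline\Omega\}$. For $\gamma\in H^1$ put $L(\gamma)=\frac\beta2\int_0^1|\dot\gamma|^2dt+\alpha$ and $a_\gamma=1/L(\gamma)$. For $\gamma\in H^1_\Omega$ put $\mu_\gamma=(\rho_\gamma,m_\gamma)\in\mathcal M$ with $\rho_\gamma=a_\gamma\,dt\otimes\delta_{\gamma(t)}$ and $m_\gamma=\dot\gamma(t)\rho_\gamma$. *Regularizer.* For $(\rho,m)\in\mathcal M$ set $J_{\alpha,\beta}(\rho,m)=\beta\int_X\Psi\big(\tfrac{d\rho}{d\lambda},\tfrac{dm}{d\lambda}\big)d\lambda+\alpha\|\rho\|_{\mathcal M(X)}$ if $\partial_t\rho+\operatorname{div}m=0$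 in $X$, that is, $\int_X\partial_t\varphi\,d\rho+\int_X\nabla\varphi\cdot dm=0$ for all $\varphi\in C^\infty_c(X)$, and $J_{\alpha,\beta}(\rho,m)=+\infty$ otherwise. Here $\lambda\ge0$ is any finite measure with $\rho,m\ll\lambda$, and $\Psi(s,x)=|x|^2/(2s)$ if $s>0$, $\Psi(0,0)=0$, $\Psi=+\infty$ otherwise. *Sampling spaces.* Let $(H_t)_{t\in[0,1]}$ be real Hilbert spaces, $D$ a real Banach space and $i_t:D\to H_t$ bounded linear operators such that $\|i_t\|\le C$ and $i_t(D)$ is dense in $H_t$ for a.e. $t$ (with $C$ independent of $t$), and $t\mapsto\langle i_t\varphi,i_t\psi\rangle_{H_t}$ is Lebesgue measurable for all $\varphi,\psi\in D$. A map $t\mapsto f_t\in H_t$ is *strongly measurable* if it is an a.e. limit of maps $t\mapsto i_t(s_n(t))$ with $s_n:[0,1]\to D$ simple functions; $L^2_H$ is the set of strongly measurable $f$ with $\int_0^1\|f_t\|_{H_t}^2dt<\infty$. *Forward operators.* Let $C^{1,1}(\overline\Omega)$ be the space of continuous $\varphi:\overline\Omega\to\mathbb R$, differentiable in $\Omega$,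 whose gradient extends to a bounded Lipschitz map on $\overline\Omega$, with norm $\|\varphi\|_\infty+\|\nabla\varphi\|_\infty+\mathrm{Lip}(\nabla\varphi)$. Let $K_t^*:C^{1,1}(\overline\Omega)^*\to H_t$ be bounded linear operators such that, for a.e. $t$, $K_t^*$ is weak*-to-weak continuous, with pre-adjoint $K_t:H_t\to C^{1,1}(\overline\Omega)$, and $\|K_t^*\|\le C$ with $C$ independent of $t$; moreover $t\mapsto K_t^*\rho$ is strongly measurable for every $\rho\in\mathcal M(\overline\Omega)\hookrightarrow C^{1,1}(\overline\Omega)^*$. *Target functional.* Fix $f\in L^2_H$. For $\mu=(\rho,m)\in\mathcal M$ let $T_{\alpha,\beta}(\mu)=\mathcal F(\mu)+J_{\alpha,\beta}(\mu)$, where $\mathcal F(\mu)=\frac12\int_0^1\|K_t^*\rho_t-f_t\|_{H_t}^2dt$ if $\rho=dt\otimes\rho_t$ with $t\in[0,1]\mapsto\rho_t\in\mathcal M(\overline\Omega)$ narrowly continuous, and $\mathcal F(\mu)=+\infty$ otherwise. **Proposition.** Let $c_1,\dots,c_N>0$ be fixed and define $\Phi(\gamma_1,\dots,\gamma_N)=T_{\alpha,\beta}\big(\sum_{j=1}^Nc_j\mu_{\gamma_j}\big)$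 on $(H^1_\Omega)^N$. Then $\Phi$ is finite on $(H^1_\Omega)^N$. Let $\Gamma=(\gamma_1,\dots,\gamma_N)\in (H^1_\Omega)^N$ be such that $\gamma_j([0,1])\subset\Omega$ for every $j$. Then $\Phi$ is continuously Fréchet differentiable at $\Gamma$ (that is, $C^1$ in a neighbourhood of $\Gamma$ in $(H^1)^N$). Set $$w_t=-K_t\Big(\sum_{j=1}^Nc_ja_{\gamma_j}K_t^*\delta_{\gamma_j(t)}-f_t\Big),\qquad F(\gamma)=-\frac{1}{L(\gamma)}\int_0^1w_t(\gamma(t))\,dt ,$$ with $w_t$ extended by $0$ outside $\overline\Omega$. Then $t\mapsto w_t(\gamma(t))$ is integrable for every $\gamma\in H^1_\Omega$, $F$ is Fréchet differentiable at each $\gamma_j$, and $$D_\Gamma\Phi(\eta_1,\dots,\eta_N)=\sum_{j=1}^Nc_j\,D_{\gamma_j}F(\eta_j)\qquad\text{for all }\eta_1,\dots,\eta_N\in H^1 .$$ -/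

import Mathlib

open MeasureTheory Filter Topology Set
open scoped ENNReal NNReal ContDiff RealInnerProductSpace

noncomputable section

namespace DynamicInverse

/-- The Euclidean space `ℝ^d`. -/
abbrev E (d : ℕ) := EuclideanSpace ℝ (Fin d)

/-- The inclusion of the open interval `(0,1)` into `[0,1]`. -/
def incl (t : Ioo (0 : ℝ) 1) : unitInterval := ⟨t, Ioo_subset_Icc_self t.2⟩

/-! ### The Sobolev space `H¹([0,1]; ℝ^d)` -/

section Sobolev

variable {d : ℕ}

lemma integrable_of_Lp (v : Lp (E d) 2 (volume : Measure unitInterval)) :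
    Integrable v (volume : Measure unitInterval) :=
  (Lp.memLp v).integrable (by norm_num)

variable (d) in
/-- Pairs `(γ, γ')` of a continuous curve `γ : [0,1] → ℝ^d` and a function `γ' ∈ L²(0,1; ℝ^d)` such
that `γ(t) = γ(0) + ∫₀ᵗ γ'`, i.e. absolutely continuous curves with square integrable derivative. -/
def h1Pairs : Submodule ℝ (C(unitInterval, E d) × Lp (E d) 2 (volume : Measure unitInterval)) where
  carrier := {p | ∀ t : unitInterval, p.1 t = p.1 0 + ∫ s in Iic t, p.2 s}
  zero_mem' := by
    intro t
    simp
  add_mem' := by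
    intro p q hp hq t
    have : ∫ s in Iic t, (p.2 + q.2) s = (∫ s in Iic t, p.2 s) + ∫ s in Iic t, q.2 s := by
      rw [integral_congr_ae (ae_restrict_of_ae (Lp.coeFn_add p.2 q.2))]
      exact integral_add (integrable_of_Lp _).integrableOn (integrable_of_Lp _).integrableOn
    simp only [Prod.fst_add, Prod.snd_add, ContinuousMap.add_apply, this]
    rw [hp t, hq t]
    abel
  smul_mem' := by
    intro a p hp t
    have : ∫ s in Iic t, (a • p.2) s = a • ∫ s in Iic t, p.2 s := by
      rw [integral_congr_ae (ae_restrict_of_ae (Lp.coeFn_smul a p.2))]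
      exact integral_smul a _
    simp only [Prod.smul_fst, Prod.smul_snd, ContinuousMap.smul_apply, this]
    rw [hp t, smul_add]

variable (d) in
/-- The Sobolev space `H¹([0,1]; ℝ^d)`, identified with the space of absolutely continuous curves
with square integrable derivative. Its norm is defined below. -/
def H1 : Type := h1Pairs d

instance : AddCommGroup (H1 d) := inferInstanceAs (AddCommGroup (h1Pairs d))

instance : Module ℝ (H1 d) := inferInstanceAs (Module ℝ (h1Pairs d))

/-- The underlying continuous curve. -/
def H1.curve (γ : H1 d) : C(unitInterval, E d) := γ.1.1

/-- The (weak, equivalently almost everywhere) derivative of the curve. -/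
def H1.deriv (γ : H1 d) : Lp (E d) 2 (volume : Measure unitInterval) := γ.1.2

instance : CoeFun (H1 d) (fun _ => unitInterval → E d) := ⟨fun γ => γ.curve⟩

variable (d) in
/-- The linear map `γ ↦ (γ, γ')` into the Hilbert sum `L² ⊕ L²`. -/
def H1.toL2 : H1 d →ₗ[ℝ]
    WithLp 2 (Lp (E d) 2 (volume : Measure unitInterval) × Lp (E d) 2 (volume : Measure unitInterval)) where
  toFun γ := WithLp.toLp 2 (ContinuousMap.toLp 2 volume ℝ γ.curve, γ.deriv)
  map_add' γ η := by
    have h : ContinuousMap.toLp (E := E d) 2 (volume : Measure unitInterval) ℝ (γ + η).curve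
        = ContinuousMap.toLp 2 volume ℝ γ.curve + ContinuousMap.toLp 2 volume ℝ η.curve :=
      map_add _ _ _
    rw [h]
    rfl
  map_smul' a γ := by
    have h : ContinuousMap.toLp (E := E d) 2 (volume : Measure unitInterval) ℝ (a • γ).curve
        = a • ContinuousMap.toLp 2 volume ℝ γ.curve :=
      map_smul _ _ _
    rw [h]
    rfl

lemma H1.toL2_injective : Function.Injective (H1.toL2 d) := by
  rw [← LinearMap.ker_eq_bot, LinearMap.ker_eq_bot']
  intro γ hγ
  have h2 : γ.deriv = 0 := congrArg (fun z => (WithLp.ofLp z).2) hγ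
  have h1 : ContinuousMap.toLp (E := E d) 2 (volume : Measure unitInterval) ℝ γ.curve = 0 :=
    congrArg (fun z => (WithLp.ofLp z).1) hγ
  have hconst : ∀ t : unitInterval, γ t = γ 0 := by
    intro t
    have h := γ.2 t
    change γ t = γ 0 + ∫ s in Iic t, γ.deriv s at h
    rw [h, h2, integral_congr_ae (ae_restrict_of_ae (Lp.coeFn_zero _ _ _))]
    simp
  have hae : (γ.curve : unitInterval → E d) =ᵐ[volume] 0 := by
    have h := ContinuousMap.coeFn_toLp (𝕜 := ℝ) (p := 2) (volume : Measure unitInterval) γ.curve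
    rw [h1] at h
    exact h.symm.trans (Lp.coeFn_zero _ _ _)
  obtain ⟨s, hs⟩ := hae.exists
  have h0 : γ 0 = 0 := by rw [← hconst s]; exact hs
  apply Subtype.ext
  apply Prod.ext
  · ext1 t
    exact (hconst t).trans h0
  · exact h2

/-- The norm of `H¹`: `‖γ‖² = ∫₀¹ |γ|² + ∫₀¹ |γ'|²`. -/
instance : NormedAddCommGroup (H1 d) :=
  NormedAddCommGroup.induced (H1 d) _ (H1.toL2 d) H1.toL2_injective

instance : NormedSpace ℝ (H1 d) := NormedSpace.induced ℝ (H1 d) _ (H1.toL2 d)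

lemma H1.norm_sq (γ : H1 d) :
    ‖γ‖ ^ 2 = ‖ContinuousMap.toLp (E := E d) 2 (volume : Measure unitInterval) ℝ γ.curve‖ ^ 2
      + ‖γ.deriv‖ ^ 2 := by
  change ‖H1.toL2 d γ‖ ^ 2 = _
  rw [WithLp.prod_norm_sq_eq_of_L2]
  rfl

/-- The curves in `H¹([0,1]; ℝ^d)` with values in the closure of `Ω`. -/
def H1In (Ω : Set (E d)) : Type := {γ : H1 d // ∀ t, γ t ∈ closure Ω}

/-- The position at time `t` of a curve in the closure of `Ω`. -/
def H1In.pos {Ω : Set (E d)} (γ : H1In Ω) (t : unitInterval) : closure Ω := ⟨γ.1 t, γ.2 t⟩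

end Sobolev

/-! ### The space `C^{1,1}` on the closure of `Ω` -/

section C11

variable {d : ℕ} {Ω : Set (E d)}

variable (Ω) in
/-- Pairs `(φ, ∇φ)` of bounded continuous functions on the closure of `Ω` such that `∇φ` is the
gradient of `φ` in `Ω` and `∇φ` is Lipschitz. As `Ω` is dense in its closure, `φ` determines
`∇φ`. -/
def c11Pairs : Submodule ℝ
    (BoundedContinuousFunction (closure Ω) ℝ × BoundedContinuousFunction (closure Ω) (E d)) where
  carrier := {p |
    (∀ x (hx : x ∈ Ω),
      HasGradientAt (Function.extend Subtype.val p.1 0) (p.2 ⟨x, subset_closure hx⟩) x) ∧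
    ∃ L : ℝ≥0, LipschitzWith L p.2}
  zero_mem' := by
    refine ⟨fun x hx => ?_, 0, LipschitzWith.const 0⟩
    have h : Function.extend (Subtype.val : closure Ω → E d)
        ((0 : BoundedContinuousFunction (closure Ω) ℝ) : closure Ω → ℝ) 0 = fun _ => 0 := by
      funext y
      by_cases hy : y ∈ closure Ω
      · exact Subtype.val_injective.extend_apply _ _ (⟨y, hy⟩ : closure Ω)
      · exact Function.extend_apply' _ _ _ (by simpa using hy)
    change HasGradientAt (Function.extend Subtype.val
      ((0 : BoundedContinuousFunction (closure Ω) ℝ) : closure Ω → ℝ) 0) 0 x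
    rw [h]
    exact hasGradientAt_const x (0 : ℝ)
  add_mem' := by
    rintro p q ⟨hp, L, hL⟩ ⟨hq, M, hM⟩
    refine ⟨fun x hx => ?_, L + M, hL.add hM⟩
    have h : Function.extend (Subtype.val : closure Ω → E d) (p + q).1 0
        = fun y => Function.extend Subtype.val p.1 0 y + Function.extend Subtype.val q.1 0 y := by
      funext y
      by_cases hy : y ∈ closure Ω
      · have e := fun u : closure Ω → ℝ =>
          Subtype.val_injective.extend_apply u 0 (⟨y, hy⟩ : closure Ω)
        dsimp only at e
        simp only [e]
        rfl
      · have e := fun u : closure Ω → ℝ => Function.extend_apply' (f := Subtype.val) u 0 y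
          (by simpa using hy)
        simp [e]
    rw [h, hasGradientAt_iff_hasFDerivAt]
    have := (hp x hx).hasFDerivAt.add (hq x hx).hasFDerivAt
    rw [← map_add] at this
    exact this
  smul_mem' := by
    rintro a p ⟨hp, L, hL⟩
    refine ⟨fun x hx => ?_, ‖a‖₊ * L, (lipschitzWith_smul a).comp hL⟩
    have h : Function.extend (Subtype.val : closure Ω → E d) (a • p).1 0
        = fun y => a • Function.extend Subtype.val p.1 0 y := by
      funext y
      by_cases hy : y ∈ closure Ω
      · have e := fun u : closure Ω → ℝ =>
          Subtype.val_injective.extend_apply u 0 (⟨y, hy⟩ : closure Ω)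
        dsimp only at e
        simp only [e]
        rfl
      · have e := fun u : closure Ω → ℝ => Function.extend_apply' (f := Subtype.val) u 0 y
          (by simpa using hy)
        simp [e]
    rw [h, hasGradientAt_iff_hasFDerivAt]
    have := (hp x hx).hasFDerivAt.const_smul a
    have e : InnerProductSpace.toDual ℝ (E d) ((a • p).2 ⟨x, subset_closure hx⟩)
        = a • InnerProductSpace.toDual ℝ (E d) (p.2 ⟨x, subset_closure hx⟩) :=
      ((InnerProductSpace.toDual ℝ (E d)).map_smulₛₗ a (p.2 ⟨x, subset_closure hx⟩)).trans (by simp)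
    rw [e]
    exact this

variable (Ω) in
/-- The space `C^{1,1}` on the closure of `Ω`. Its norm is defined below. -/
def C11 : Type := c11Pairs Ω

instance : AddCommGroup (C11 Ω) := inferInstanceAs (AddCommGroup (c11Pairs Ω))

instance : Module ℝ (C11 Ω) := inferInstanceAs (Module ℝ (c11Pairs Ω))

/-- The underlying continuous function on the closure of `Ω`. -/
def C11.fn (φ : C11 Ω) : BoundedContinuousFunction (closure Ω) ℝ := φ.1.1

/-- The gradient, extended continuously to the closure of `Ω`. -/
def C11.grad (φ : C11 Ω) : BoundedContinuousFunction (closure Ω) (E d) := φ.1.2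

/-- The extension of `φ` by zero outside the closure of `Ω`. -/
def C11.extZero (φ : C11 Ω) : E d → ℝ := Function.extend Subtype.val φ.fn 0

/-- The optimal Lipschitz constant of a function on the closure of `Ω`, as a supremum of difference
quotients (the pairs with `q.1 = q.2` contribute `0 / 0 = 0`). -/
def lipSup (g : closure Ω → E d) : ℝ :=
  ⨆ q : closure Ω × closure Ω, ‖g q.1 - g q.2‖ / ‖(q.1 : E d) - q.2‖

lemma lipSup_bdd (φ : C11 Ω) : BddAbove (range fun q : closure Ω × closure Ω =>
    ‖φ.grad q.1 - φ.grad q.2‖ / ‖(q.1 : E d) - q.2‖) := by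
  obtain ⟨L, hL⟩ := φ.2.2
  refine ⟨L, ?_⟩
  rintro _ ⟨q, rfl⟩
  have h := hL.dist_le_mul q.1 q.2
  rw [dist_eq_norm, Subtype.dist_eq, dist_eq_norm] at h
  exact div_le_of_le_mul₀ (norm_nonneg _) L.2 h

lemma lipSup_nonneg (g : closure Ω → E d) : 0 ≤ lipSup g :=
  Real.iSup_nonneg fun _ => by positivity

/-- The norm `‖φ‖_∞ + ‖∇φ‖_∞ + Lip(∇φ)`. -/
instance : Norm (C11 Ω) := ⟨fun φ => ‖φ.fn‖ + ‖φ.grad‖ + lipSup φ.grad⟩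

lemma C11.norm_def (φ : C11 Ω) : ‖φ‖ = ‖φ.fn‖ + ‖φ.grad‖ + lipSup φ.grad := rfl

lemma C11.core : NormedSpace.Core ℝ (C11 Ω) where
  norm_nonneg φ := add_nonneg (by positivity) (lipSup_nonneg _)
  norm_smul a φ := by
    have h : lipSup (a • φ).grad = ‖a‖ * lipSup φ.grad := by
      rw [lipSup, lipSup, Real.mul_iSup_of_nonneg (norm_nonneg a)]
      congr 1
      funext q
      change ‖a • φ.grad q.1 - a • φ.grad q.2‖ / _ = _
      rw [← smul_sub, norm_smul, mul_div_assoc]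
    have h1 : ‖(a • φ).fn‖ = ‖a‖ * ‖φ.fn‖ := norm_smul a φ.fn
    have h2 : ‖(a • φ).grad‖ = ‖a‖ * ‖φ.grad‖ := norm_smul a φ.grad
    rw [C11.norm_def, C11.norm_def, h, h1, h2]
    ring
  norm_triangle φ ψ := by
    have h : lipSup (φ + ψ).grad ≤ lipSup φ.grad + lipSup ψ.grad := by
      refine Real.iSup_le (fun q => ?_) (add_nonneg (lipSup_nonneg _) (lipSup_nonneg _))
      refine le_trans ?_ (add_le_add (le_ciSup (lipSup_bdd φ) q) (le_ciSup (lipSup_bdd ψ) q))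
      change ‖(φ.grad q.1 + ψ.grad q.1) - (φ.grad q.2 + ψ.grad q.2)‖ / _ ≤ _
      rw [add_sub_add_comm, ← add_div]
      gcongr
      exact norm_add_le _ _
    have h1 : ‖(φ + ψ).fn‖ ≤ ‖φ.fn‖ + ‖ψ.fn‖ := norm_add_le φ.fn ψ.fn
    have h2 : ‖(φ + ψ).grad‖ ≤ ‖φ.grad‖ + ‖ψ.grad‖ := norm_add_le φ.grad ψ.grad
    rw [C11.norm_def, C11.norm_def, C11.norm_def]
    linarith
  norm_eq_zero_iff φ := by
    constructor
    · intro h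
      rw [C11.norm_def] at h
      have := lipSup_nonneg φ.grad
      have h1 : φ.fn = 0 := norm_eq_zero.1 (le_antisymm
        (by linarith [norm_nonneg φ.grad]) (norm_nonneg _))
      have h2 : φ.grad = 0 := norm_eq_zero.1 (le_antisymm
        (by linarith [norm_nonneg φ.fn]) (norm_nonneg _))
      exact Subtype.ext (Prod.ext h1 h2)
    · rintro rfl
      have h1 : ‖(0 : C11 Ω).fn‖ = 0 := norm_zero (E := BoundedContinuousFunction (closure Ω) ℝ)
      have h2 : ‖(0 : C11 Ω).grad‖ = 0 :=
        norm_zero (E := BoundedContinuousFunction (closure Ω) (E d))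
      have h3 : lipSup (0 : C11 Ω).grad = 0 := by
        refine le_antisymm (Real.iSup_le (fun q => ?_) le_rfl) (lipSup_nonneg _)
        change ‖(0 : E d) - 0‖ / _ ≤ _
        simp
      rw [C11.norm_def, h1, h2, h3]
      simp

instance : NormedAddCommGroup (C11 Ω) := NormedAddCommGroup.ofCore C11.core

instance : NormedSpace ℝ (C11 Ω) := NormedSpace.ofCore C11.core

lemma C11.norm_fn_le (φ : C11 Ω) : ‖φ.fn‖ ≤ ‖φ‖ := by
  rw [C11.norm_def]
  linarith [norm_nonneg φ.grad, lipSup_nonneg φ.grad]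

lemma isFiniteMeasure_variation {X : Type*} [MeasurableSpace X] (ρ : SignedMeasure X) :
    IsFiniteMeasure ρ.variation := by
  rw [← SignedMeasure.totalVariation_eq_variation, SignedMeasure.totalVariation]
  infer_instance

lemma integrable_variation (ρ : SignedMeasure (closure Ω))
    (φ : BoundedContinuousFunction (closure Ω) ℝ) : ρ.Integrable φ := by
  have := isFiniteMeasure_variation ρ
  exact φ.integrable _

/-- The embedding of the bounded signed Borel measures on the closure of `Ω` into the dual of
`C^{1,1}`, given by `φ ↦ ∫ φ dρ`. -/
def measToDual (ρ : SignedMeasure (closure Ω)) : StrongDual ℝ (C11 Ω) :=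
  LinearMap.mkContinuous
    { toFun := fun φ => ∫ᵛ x, φ.fn x ∂•ρ
      map_add' := fun φ ψ => VectorMeasure.integral_add
        (integrable_variation ρ φ.fn) (integrable_variation ρ ψ.fn)
      map_smul' := fun a φ => by
        exact VectorMeasure.integral_fun_smul ρ (ContinuousLinearMap.lsmul ℝ ℝ) a φ.fn }
    (‖ContinuousLinearMap.lsmul (E := ℝ) ℝ ℝ‖ * ρ.variation.real univ)
    (by
      intro φ
      have := isFiniteMeasure_variation ρ
      have h := VectorMeasure.norm_integral_le_of_norm_le_const (μ := ρ)
        (B := ContinuousLinearMap.lsmul (E := ℝ) ℝ ℝ)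
        (f := φ.fn) (C := ‖φ‖)
        (ae_of_all _ fun x => (φ.fn.norm_coe_le_norm x).trans φ.norm_fn_le)
      exact h.trans (le_of_eq (by ring)))

/-- The Dirac mass `δ_x`, as an element of the dual of `C^{1,1}`. -/
def diracDual (x : closure Ω) : StrongDual ℝ (C11 Ω) :=
  measToDual (Measure.dirac x).toSignedMeasure

end C11

/-! ### Measures on the time-space cylinder and the optimal transport regularizer -/

section Transport

variable {d : ℕ} {Ω : Set (E d)}

variable (Ω) in
/-- The time-space cylinder `X = (0,1) × Ω̄`. -/
abbrev Cylinder := Ioo (0 : ℝ) 1 × closure Ω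

/-- The Lebesgue measure `dt` on `(0,1)`. -/
def dt : Measure (Ioo (0 : ℝ) 1) := Measure.comap Subtype.val volume

instance : IsFiniteMeasure dt :=
  ⟨by
    rw [dt, comap_subtype_coe_apply measurableSet_Ioo, image_univ, Subtype.range_coe,
      Real.volume_Ioo]
    exact ENNReal.ofReal_lt_top⟩

variable (Ω) in
/-- The space `𝓜 = 𝓜(X) × 𝓜(X; ℝ^d)` of pairs `μ = (ρ, m)`. -/
abbrev MeasPair := SignedMeasure (Cylinder Ω) × VectorMeasure (Cylinder Ω) (E d)

/-- The distributional continuity equation `∂_t ρ + div m = 0` in `X`. The elements of `C_c^∞(X)`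
are the restrictions to `X` of smooth compactly supported functions on `ℝ × ℝ^d` whose support is
contained in `(0,1) × ℝ^d`; there is no condition at the boundary of `Ω`. -/
def ContinuityEq (μ : MeasPair Ω) : Prop :=
  ∀ φ : ℝ × E d → ℝ, ContDiff ℝ ∞ φ → HasCompactSupport φ →
    tsupport φ ⊆ Ioo (0 : ℝ) 1 ×ˢ (univ : Set (E d)) →
    (∫ᵛ p, deriv (fun s : ℝ => φ (s, (p.2 : E d))) (p.1 : ℝ) ∂•μ.1)
      + (∫ᵛ p, gradient (fun y : E d => φ ((p.1 : ℝ), y)) (p.2 : E d) ∂[innerSL ℝ; μ.2]) = 0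

/-- The Benamou-Brenier integrand `Ψ`. -/
def Psi (s : ℝ) (x : E d) : ℝ≥0∞ :=
  if 0 < s then ENNReal.ofReal (‖x‖ ^ 2 / (2 * s))
  else if s = 0 ∧ x = 0 then 0 else ⊤

/-- The `i`-th component of an `ℝ^d`-valued measure. -/
def component {X : Type*} [MeasurableSpace X] (m : VectorMeasure X (E d)) (i : Fin d) :
    SignedMeasure X :=
  m.mapRange (EuclideanSpace.proj (𝕜 := ℝ) i : E d →L[ℝ] ℝ).toLinearMap.toAddMonoidHom
    (EuclideanSpace.proj (𝕜 := ℝ) i : E d →L[ℝ] ℝ).continuous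

/-- The positive measure `|ρ| + ∑ i, |m_i|`, with respect to which `ρ` and `m` are absolutely
continuous. -/
def refMeasure (μ : MeasPair Ω) : Measure (Cylinder Ω) :=
  μ.1.variation + ∑ i, (component μ.2 i).variation

/-- The Benamou-Brenier energy `B(ρ, m) = ∫ Ψ(dρ/dλ, dm/dλ) dλ`. By one-homogeneity of `Ψ` it does
not depend on the measure `λ` with `ρ, m ≪ λ`; we take `λ = |ρ| + ∑ i, |m_i|`. -/
def benamouBrenier (μ : MeasPair Ω) : ℝ≥0∞ :=
  ∫⁻ p, Psi (μ.1.rnDeriv (refMeasure μ) p)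
    (WithLp.toLp 2 fun i => (component μ.2 i).rnDeriv (refMeasure μ) p : E d) ∂(refMeasure μ)

open Classical in
/-- The regularizer `J_{α,β}`: it equals `β B(ρ, m) + α ‖ρ‖` if `(ρ, m)` solves the continuity
equation, and `+∞` otherwise. -/
def regularizer (α β : ℝ) (μ : MeasPair Ω) : ℝ≥0∞ :=
  if ContinuityEq μ then
    ENNReal.ofReal β * benamouBrenier μ + ENNReal.ofReal α * μ.1.variation univ
  else ⊤

/-- The curve of measures `t ↦ ρ_t` is narrowly continuous on `[0,1]`. -/
def NarrowlyContinuous (r : unitInterval → SignedMeasure (closure Ω)) : Prop :=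
  ∀ φ : BoundedContinuousFunction (closure Ω) ℝ, Continuous fun t => ∫ᵛ x, φ x ∂•(r t)

/-- `ρ = dt ⊗ ρ_t`: the family `t ↦ ρ_t` is Borel, and `ρ(A) = ∫₀¹ ρ_t({x : (t,x) ∈ A}) dt` for
every Borel set `A`. -/
def Disintegrates (ρ : SignedMeasure (Cylinder Ω)) (r : unitInterval → SignedMeasure (closure Ω)) : Prop :=
  (∀ B : Set (closure Ω), MeasurableSet B → Measurable fun t => r t B) ∧
  ∀ A : Set (Cylinder Ω), MeasurableSet A →
    Integrable (fun t : Ioo (0 : ℝ) 1 => r (incl t) {x | (t, x) ∈ A}) dt ∧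
    ρ A = ∫ t : Ioo (0 : ℝ) 1, r (incl t) {x | (t, x) ∈ A} ∂dt

/-- `L(γ) = (β/2) ∫₀¹ |γ'|² dt + α`. -/
def len (α β : ℝ) (γ : H1 d) : ℝ := β / 2 * (∫ t, ‖γ.deriv t‖ ^ 2) + α

/-- `a_γ = 1 / L(γ)`. -/
def weight (α β : ℝ) (γ : H1 d) : ℝ := (len α β γ)⁻¹

/-- The measure `dt ⊗ δ_{γ(t)}` on `X`. -/
def graphMeasure (γ : H1In Ω) : Measure (Cylinder Ω) :=
  Measure.map (fun t : Ioo (0 : ℝ) 1 => (t, γ.pos (incl t))) dt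

instance (γ : H1In Ω) : IsFiniteMeasure (graphMeasure γ) := by
  unfold graphMeasure
  infer_instance

/-- The pair `μ_γ = (ρ_γ, m_γ)`, where `ρ_γ = a_γ dt ⊗ δ_{γ(t)}` and `m_γ = γ'(t) ρ_γ`. -/
def curveMeasure (α β : ℝ) (γ : H1In Ω) : MeasPair Ω :=
  (weight α β γ.1 • (graphMeasure γ).toSignedMeasure,
    weight α β γ.1 • (graphMeasure γ).withDensityᵥ fun p => γ.1.deriv (incl p.1))

/-- `μ(Γ) = ∑ j, c_j μ_{γ_j}`. -/
def tupleMeasure (α β : ℝ) {N : ℕ} (c : Fin N → ℝ) (Γ : Fin N → H1In Ω) : MeasPair Ω :=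
  ∑ j, c j • curveMeasure α β (Γ j)

end Transport

/-! ### Time dependent Hilbert spaces and forward operators -/

section Operators

variable {d : ℕ} {Ω : Set (E d)}
  {H : unitInterval → Type*} [∀ t, NormedAddCommGroup (H t)] [∀ t, InnerProductSpace ℝ (H t)]
  {D : Type*} [NormedAddCommGroup D] [NormedSpace ℝ D]

/-- The assumptions on the sampling spaces: the operators `i_t : D → H_t` are uniformly bounded with
dense range, and `t ↦ ⟪i_t φ, i_t ψ⟫` is Lebesgue measurable. -/
structure SamplingAssumptions (i : ∀ t, D →L[ℝ] H t) : Prop where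
  bounded : ∃ C : ℝ, ∀ᵐ t, ‖i t‖ ≤ C
  dense : ∀ᵐ t, DenseRange (i t)
  measurable : ∀ φ ψ : D, AEMeasurable fun t => ⟪i t φ, i t ψ⟫

/-- Strong measurability of `t ↦ f_t ∈ H_t`: it is almost everywhere the limit of maps
`t ↦ i_t (s_n(t))` with `s_n` a simple function with values in `D`. -/
def StronglyMeas (i : ∀ t, D →L[ℝ] H t) (f : ∀ t, H t) : Prop :=
  ∃ s : ℕ → SimpleFunc unitInterval D, ∀ᵐ t, Tendsto (fun n => i t (s n t)) atTop (𝓝 (f t))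

/-- Membership in `L²([0,1]; H)`. -/
def MemL2H (i : ∀ t, D →L[ℝ] H t) (f : ∀ t, H t) : Prop :=
  StronglyMeas i f ∧ ∫⁻ t, ‖f t‖ₑ ^ 2 < ⊤

/-- Weak*-to-weak continuity of an operator on the dual of `V`. -/
def WeakStarWeakContinuous {V G : Type*} [NormedAddCommGroup V] [NormedSpace ℝ V]
    [NormedAddCommGroup G] [NormedSpace ℝ G] (A : StrongDual ℝ V →L[ℝ] G) : Prop :=
  Continuous fun ρ : WeakDual ℝ V => toWeakSpace ℝ G (A (WeakDual.toStrongDual ρ))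

/-- The assumptions on the forward operators `K_t^*`: they are weak*-to-weak continuous and uniformly
bounded, and `t ↦ K_t^* ρ` is strongly measurable for every measure `ρ` on the closure of `Ω`. -/
structure ForwardAssumptions (i : ∀ t, D →L[ℝ] H t)
    (Ks : ∀ t, StrongDual ℝ (C11 Ω) →L[ℝ] H t) : Prop where
  weak_continuous : ∀ᵐ t, WeakStarWeakContinuous (Ks t)
  bounded : ∃ C : ℝ, ∀ᵐ t, ‖Ks t‖ ≤ C
  measurable : ∀ ρ : SignedMeasure (closure Ω), StronglyMeas i fun t => Ks t (measToDual ρ)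

/-- The pre-adjoint `G → V` of an operator `A : V* → G`, characterized by
`⟪A ρ, h⟫ = ρ (preadjoint A h)` whenever `A` is weak*-to-weak continuous
(see `inner_eq_preadjoint`). -/
def preadjoint {V G : Type*} [NormedAddCommGroup V] [NormedSpace ℝ V]
    [NormedAddCommGroup G] [InnerProductSpace ℝ G] (A : StrongDual ℝ V →L[ℝ] G) (h : G) : V :=
  Classical.epsilon fun v : V => ∀ ρ : StrongDual ℝ V, ⟪A ρ, h⟫ = ρ v

lemma inner_eq_preadjoint {V G : Type*} [NormedAddCommGroup V] [NormedSpace ℝ V]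
    [NormedAddCommGroup G] [InnerProductSpace ℝ G] {A : StrongDual ℝ V →L[ℝ] G}
    (hA : WeakStarWeakContinuous A) (h : G) (ρ : StrongDual ℝ V) :
    ⟪A ρ, h⟫ = ρ (preadjoint A h) := by
  let g : StrongDual ℝ (WeakDual ℝ V) :=
    { toFun := fun σ => ⟪A (WeakDual.toStrongDual σ), h⟫
      map_add' := fun σ τ => by rw [map_add, map_add, inner_add_left]
      map_smul' := fun a σ => by
        rw [map_smul, map_smul, real_inner_smul_left]
        rfl
      cont := by
        have e := (WeakBilin.eval_continuous (topDualPairing ℝ G).flip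
          (innerSL ℝ h : StrongDual ℝ G)).comp hA
        refine e.congr fun σ => ?_
        exact real_inner_comm _ _ }
  obtain ⟨v, hv⟩ := LinearMap.dualEmbedding_surjective (topDualPairing ℝ V) g
  have hex : ∃ v : V, ∀ σ : StrongDual ℝ V, ⟪A σ, h⟫ = σ v :=
    ⟨v, fun σ => (DFunLike.congr_fun hv (StrongDual.toWeakDual σ)).symm⟩
  exact Classical.epsilon_spec hex ρ

/-- The fidelity term: `(1/2) ∫₀¹ ‖K_t^* ρ_t - f_t‖² dt` if `ρ = dt ⊗ ρ_t` with `t ↦ ρ_t` narrowly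
continuous (such a curve is unique), and `+∞` if there is no such curve. -/
def fidelity (Ks : ∀ t, StrongDual ℝ (C11 Ω) →L[ℝ] H t) (f : ∀ t, H t) (μ : MeasPair Ω) : ℝ≥0∞ :=
  ⨅ (r : unitInterval → SignedMeasure (closure Ω)) (_ : Disintegrates μ.1 r ∧ NarrowlyContinuous r),
    (1 / 2) * ∫⁻ t, ‖Ks t (measToDual (r t)) - f t‖ₑ ^ 2

/-- The Tikhonov functional `T_{α,β}`. -/
def tikhonov (Ks : ∀ t, StrongDual ℝ (C11 Ω) →L[ℝ] H t) (f : ∀ t, H t) (α β : ℝ)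
    (μ : MeasPair Ω) : ℝ≥0∞ :=
  fidelity Ks f μ + regularizer α β μ

open Classical in
/-- `Φ(γ_1, …, γ_N) = T_{α,β}(∑ j, c_j μ_{γ_j})` for curves in the closure of `Ω` (and `0` on the
other tuples in `(H¹)^N`). -/
def slidingFunctional (Ks : ∀ t, StrongDual ℝ (C11 Ω) →L[ℝ] H t) (f : ∀ t, H t) (α β : ℝ)
    {N : ℕ} (c : Fin N → ℝ) (Γ : Fin N → H1 d) : ℝ :=
  if h : ∀ j t, Γ j t ∈ closure Ω then
    (tikhonov Ks f α β (tupleMeasure α β c fun j => (⟨Γ j, h j⟩ : H1In Ω))).toReal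
  else 0

/-- The dual variable `w_t = -K_t (∑ j, c_j a_{γ_j} K_t^* δ_{γ_j(t)} - f_t)`. -/
def dualVariable (Ks : ∀ t, StrongDual ℝ (C11 Ω) →L[ℝ] H t) (f : ∀ t, H t) (α β : ℝ)
    {N : ℕ} (c : Fin N → ℝ) (Γ : Fin N → H1In Ω) (t : unitInterval) : C11 Ω :=
  -preadjoint (Ks t) ((∑ j, (c j * weight α β (Γ j).1) • Ks t (diracDual ((Γ j).pos t))) - f t)

/-- `W(γ) = -∫₀¹ w_t(γ(t)) dt`, with `w_t` extended by zero outside the closure of `Ω`. -/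
def dualWork (w : unitInterval → C11 Ω) (γ : H1 d) : ℝ := -∫ t, (w t).extZero (γ t)

/-- `F(γ) = W(γ) / L(γ)`. -/
def insertionFunctional (α β : ℝ) (w : unitInterval → C11 Ω) (γ : H1 d) : ℝ :=
  dualWork w γ / len α β γ

end Operators

end DynamicInverse

end

open DynamicInverse

noncomputable section

namespace DynamicInverse

/-! ### Point evaluation on `H1` and smoothness of the weight -/

section SobolevBasics

variable {d : ℕ}

/-! The regularizer is constant on superpositions of curves, so only the fidelity term has to be
differentiated.

Two curves have equal derivatives at almost every time at which they coincide, because isolated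
points of the coincidence set are countable. Hence the momenta of all `γ_j` come from one velocity
field `tupleVelocity` against the positive measure `tupleDensity`, and no energy is lost where
curves overlap. The energy is then additive: each curve contributes `c_j a_{γ_j} L(γ_j) = c_j`, and
the regularizer equals `∑ c_j` (`regularizer_tupleMeasure`). The continuity equation is the chain
rule along a curve (`integral_chain_rule`).

Disintegrations are unique almost everywhere, so the fidelity is half the squared `L²` norm of the
residual `r_t = ∑ c_j a_{γ_j} K_t^* δ_{γ_j(t)} - f_t` (`fidelity_tupleMeasure`).

The map `x ↦ δ_x` into the dual of `C^{1,1}` is differentiable in `Ω`, and its derivative is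
Lipschitz there: bounded Lipschitz gradients make the first-order expansion uniform over test
functions (`norm_diracExt_sub_le`). Composing with evaluation on `H1` and with the smooth weight,
then differentiating under the integral by dominated convergence, gives `fidelity_differentiable`,
with derivative `∫ ⟪r_t, D r_t⟫`.

By the pre-adjoint identity, the insertion functional is `γ ↦ ∫ ⟪r_t, a_γ K_t^* δ_{γ(t)}⟫` with `r`
frozen at the base tuple (`insertionFunctional_eq`). Its derivative at `γ_j` is therefore exactly
the `j`-th summand of the derivative above.

Measurability in the varying spaces `H t` is handled by duality through `BiMeas`, a class closed
under weak limits. -/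

lemma setIntegral_norm_le (g : Lp (E d) 2 (volume : Measure unitInterval)) (A : Set unitInterval) :
    ∫ s in A, ‖g s‖ ≤ ‖g‖ * √(volume.real A) := by
  have hg : AEStronglyMeasurable g (volume.restrict A) := (Lp.aestronglyMeasurable g).restrict
  have h := eLpNorm_le_eLpNorm_mul_rpow_measure_univ (p := 1) (q := 2) (by norm_num) hg
  rw [integral_norm_eq_lintegral_enorm hg, ← eLpNorm_one_eq_lintegral_enorm]
  have h2 : eLpNorm g 2 (volume.restrict A) ≤ eLpNorm g 2 volume :=
    eLpNorm_mono_measure _ Measure.restrict_le_self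
  have h3 := h.trans (mul_le_mul_left h2 _)
  have h4 : (1 / (1 : ℝ≥0∞).toReal - 1 / (2 : ℝ≥0∞).toReal) = 1 / 2 := by norm_num
  rw [h4, Measure.restrict_apply_univ] at h3
  refine (ENNReal.toReal_mono ?_ h3).trans_eq ?_
  · exact ENNReal.mul_ne_top (Lp.memLp g).2.ne (ENNReal.rpow_ne_top_of_nonneg (by norm_num)
      (measure_ne_top _ _))
  · rw [ENNReal.toReal_mul, ← ENNReal.toReal_rpow, Real.sqrt_eq_rpow, Lp.norm_def]
    rfl

lemma H1.apply_eq (γ : H1 d) (t : unitInterval) :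
    γ t = γ 0 + ∫ s in Iic t, γ.deriv s := γ.2 t

lemma H1.norm_sub_le_integral (γ : H1 d) {s t : unitInterval} (h : s ≤ t) :
    ‖γ t - γ s‖ ≤ ∫ r in Ioc s t, ‖γ.deriv r‖ := by
  have hi := integrable_of_Lp γ.deriv
  have e : (∫ r in Iic t, γ.deriv r) = (∫ r in Iic s, γ.deriv r) + ∫ r in Ioc s t, γ.deriv r := by
    rw [← setIntegral_union (by
      rw [Set.disjoint_left]; intro x hx hx'; exact absurd hx'.1 (not_lt.2 hx)) measurableSet_Ioc
      hi.integrableOn hi.integrableOn, Iic_union_Ioc_eq_Iic h]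
  rw [γ.apply_eq t, γ.apply_eq s, e]
  have : (γ 0 + ((∫ r in Iic s, γ.deriv r) + ∫ r in Ioc s t, γ.deriv r)) -
    (γ 0 + ∫ r in Iic s, γ.deriv r) = ∫ r in Ioc s t, γ.deriv r := by abel
  rw [this]
  exact norm_integral_le_integral_norm _

/-- Cauchy–Schwarz on the interval between `s` and `t`. This Hölder modulus is what makes evaluation
norm continuous in time. -/
lemma H1.norm_sub_le (γ : H1 d) (s t : unitInterval) :
    ‖γ t - γ s‖ ≤ ‖γ.deriv‖ * √(dist t s) := by
  wlog h : s ≤ t generalizing s t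
  · rw [norm_sub_rev, dist_comm]
    exact this t s (le_of_not_ge h)
  refine (γ.norm_sub_le_integral h).trans ((setIntegral_norm_le γ.deriv _).trans_eq ?_)
  have h1 : (0 : ℝ) ≤ (t : ℝ) - s := sub_nonneg.2 h
  rw [Measure.real, unitInterval.volume_Ioc, ENNReal.toReal_ofReal h1, Subtype.dist_eq,
    Real.dist_eq, abs_of_nonneg h1]

lemma H1.norm_deriv_le (γ : H1 d) : ‖γ.deriv‖ ≤ ‖γ‖ := by
  have := γ.norm_sq
  refine le_of_sq_le_sq ?_ (norm_nonneg _)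
  nlinarith [sq_nonneg ‖ContinuousMap.toLp (E := E d) 2 (volume : Measure unitInterval) ℝ γ.curve‖]

lemma H1.norm_toLp_le (γ : H1 d) :
    ‖ContinuousMap.toLp (E := E d) 2 (volume : Measure unitInterval) ℝ γ.curve‖ ≤ ‖γ‖ := by
  have := γ.norm_sq
  refine le_of_sq_le_sq ?_ (norm_nonneg _)
  nlinarith [sq_nonneg ‖γ.deriv‖]

/-- Values at two times differ by at most `‖γ‖`; averaging over the second time leaves the mean of
`‖γ s‖`, again at most `‖γ‖`. This gives the constant 2. -/
lemma H1.norm_apply_le (γ : H1 d) (t : unitInterval) : ‖γ t‖ ≤ 2 * ‖γ‖ := by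
  have h1 : ∀ s, ‖γ t‖ ≤ ‖γ s‖ + ‖γ‖ := by
    intro s
    have h := γ.norm_sub_le s t
    have h2 : √(dist t s) ≤ 1 := by
      rw [Real.sqrt_le_iff, one_pow, Subtype.dist_eq, Real.dist_eq, abs_le]
      refine ⟨zero_le_one, ?_⟩
      constructor <;> linarith [t.2.1, t.2.2, s.2.1, s.2.2]
    have h3 : ‖γ.deriv‖ * √(dist t s) ≤ ‖γ‖ :=
      (mul_le_of_le_one_right (norm_nonneg _) h2).trans γ.norm_deriv_le
    linarith [norm_le_norm_add_norm_sub' (γ t) (γ s)]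
  have hc : Continuous fun s => ‖γ s‖ := γ.curve.continuous.norm
  have hi : Integrable fun s => ‖γ s‖ := hc.integrable_of_hasCompactSupport
    (HasCompactSupport.of_compactSpace _)
  have h2 : ‖γ t‖ ≤ (∫ s : unitInterval, ‖γ s‖) + ‖γ‖ := by
    have := integral_mono (μ := (volume : Measure unitInterval)) (integrable_const ‖γ t‖)
      (hi.add (integrable_const ‖γ‖)) h1
    rw [integral_const] at this
    simp only [Pi.add_apply] at this
    rw [integral_add hi (integrable_const _), integral_const] at this
    simpa using this
  have h3 := setIntegral_norm_le
    (ContinuousMap.toLp (E := E d) 2 (volume : Measure unitInterval) ℝ γ.curve) univ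
  rw [Measure.restrict_univ] at h3
  have h4 : ∫ s, ‖ContinuousMap.toLp (E := E d) 2 (volume : Measure unitInterval) ℝ γ.curve s‖
      = ∫ s : unitInterval, ‖γ s‖ := by
    refine integral_congr_ae ?_
    filter_upwards [ContinuousMap.coeFn_toLp (𝕜 := ℝ) (p := 2) (volume : Measure unitInterval)
      γ.curve] with s hs
    rw [hs]
  rw [h4] at h3
  have h5 : volume.real (univ : Set unitInterval) = 1 := by simp
  rw [h5] at h3
  simp only [Real.sqrt_one, mul_one] at h3
  linarith [γ.norm_toLp_le]

variable (d) in
/-- The derivative, as a continuous linear map from `H¹` to `L²`. -/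
def derivCLM : H1 d →L[ℝ] Lp (E d) 2 (volume : Measure unitInterval) :=
  LinearMap.mkContinuous ⟨⟨H1.deriv, fun _ _ => rfl⟩, fun _ _ => rfl⟩ 1
    (fun γ => by rw [one_mul]; exact γ.norm_deriv_le)

/-- The evaluation at time `t`, as a continuous linear map on `H¹`. -/
def evalCLM (t : unitInterval) : H1 d →L[ℝ] E d :=
  LinearMap.mkContinuous ⟨⟨fun γ => γ t, fun _ _ => rfl⟩, fun _ _ => rfl⟩ 2
    (fun γ => γ.norm_apply_le t)

@[simp]
lemma evalCLM_apply (t : unitInterval) (γ : H1 d) : evalCLM t γ = γ t := rfl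

lemma norm_evalCLM_le (t : unitInterval) : ‖(evalCLM t : H1 d →L[ℝ] E d)‖ ≤ 2 :=
  LinearMap.mkContinuous_norm_le _ (by norm_num) _

/-- Continuity in operator norm, not only pointwise, is used for strong measurability of
operator-valued integrands. -/
lemma continuous_evalCLM : Continuous fun t => (evalCLM t : H1 d →L[ℝ] E d) := by
  rw [continuous_iff_continuousAt]
  intro s
  rw [ContinuousAt, tendsto_iff_norm_sub_tendsto_zero]
  have h0 : Tendsto (fun t : unitInterval => √(dist t s)) (𝓝 s) (𝓝 0) := by
    have : Continuous fun t : unitInterval => √(dist t s) := by fun_prop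
    simpa using this.tendsto s
  refine squeeze_zero (fun _ => norm_nonneg _) (fun t => ?_) h0
  refine ContinuousLinearMap.opNorm_le_bound _ (Real.sqrt_nonneg _) fun γ => ?_
  have := (γ.norm_sub_le s t).trans (mul_le_mul_of_nonneg_right γ.norm_deriv_le (Real.sqrt_nonneg _))
  simpa [mul_comm] using this

/-- `H1` embeds continuously in the continuous curves, where the condition is open because the time
interval is compact. -/
lemma isOpen_forall_mem {Ω : Set (E d)} (hΩ : IsOpen Ω) : IsOpen {γ : H1 d | ∀ t, γ t ∈ Ω} := by
  let F : H1 d →L[ℝ] C(unitInterval, E d) :=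
    LinearMap.mkContinuous ⟨⟨H1.curve, fun _ _ => rfl⟩, fun _ _ => rfl⟩ 2
      (fun γ => (ContinuousMap.norm_le _ (by positivity)).2 γ.norm_apply_le)
  have h := (ContinuousMap.isOpen_setOfPred_mapsTo (X := unitInterval) (Y := E d)
    isCompact_univ hΩ).preimage F.continuous
  convert h using 1
  ext γ
  exact ⟨fun h t _ => h t, fun h t => h (mem_univ t)⟩

lemma integral_norm_deriv_sq (γ : H1 d) : ∫ t, ‖γ.deriv t‖ ^ 2 = ‖γ.deriv‖ ^ 2 := by
  rw [← real_inner_self_eq_norm_sq, MeasureTheory.L2.inner_def]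
  simp

lemma len_eq (α β : ℝ) (γ : H1 d) : len α β γ = β / 2 * ‖derivCLM d γ‖ ^ 2 + α := by
  rw [len, integral_norm_deriv_sq]
  rfl

lemma le_len {α β : ℝ} (hβ : 0 < β) (γ : H1 d) : α ≤ len α β γ := by
  rw [len_eq]
  have : 0 ≤ β / 2 * ‖derivCLM d γ‖ ^ 2 := by positivity
  linarith

lemma weight_pos {α β : ℝ} (hα : 0 < α) (hβ : 0 < β) (γ : H1 d) : 0 < weight α β γ :=
  inv_pos.2 (hα.trans_le (le_len hβ γ))

lemma weight_le {α β : ℝ} (hα : 0 < α) (hβ : 0 < β) (γ : H1 d) : weight α β γ ≤ α⁻¹ :=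
  inv_anti₀ hα (le_len hβ γ)

lemma contDiff_weight {α β : ℝ} (hα : 0 < α) (hβ : 0 < β) :
    ContDiff ℝ 1 (weight α β : H1 d → ℝ) := by
  have h : ContDiff ℝ 1 (len α β : H1 d → ℝ) := by
    have e : (len α β : H1 d → ℝ) = fun γ => β / 2 * ‖derivCLM d γ‖ ^ 2 + α := by
      funext γ
      exact len_eq α β γ
    rw [e]
    exact (contDiff_const.mul ((derivCLM d).contDiff.norm_sq ℝ)).add contDiff_const
  exact h.inv fun γ => (hα.trans_le (le_len hβ γ)).ne'

end SobolevBasics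

/-- The endpoints are null. This is the bridge between measures, which live over the open interval,
and curves, which live on the closed one. -/
lemma measurePreserving_incl : MeasurePreserving incl dt volume := by
  have hm : Measurable incl := by
    unfold incl
    fun_prop
  refine ⟨hm, ?_⟩
  have h1 : (dt.map incl).map ((↑) : unitInterval → ℝ) = volume.restrict (Ioo 0 1) := by
    rw [Measure.map_map measurable_subtype_coe hm]
    exact map_comap_subtype_coe measurableSet_Ioo volume
  have h2 : (volume : Measure unitInterval).map ((↑) : unitInterval → ℝ)
      = volume.restrict (Ioo 0 1) := by
    rw [unitInterval.measurePreserving_coe.map_eq]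
    exact restrict_Ioo_eq_restrict_Icc.symm
  rw [← unitInterval.measurableEmbedding_coe.comap_map (dt.map incl), h1, ← h2,
    unitInterval.measurableEmbedding_coe.comap_map]

/-! ### Almost everywhere derivatives and coincidence sets of curves -/

section Derivative

variable {d : ℕ}

/-- The extension of a curve to the real line by constants. -/
def H1.ext (γ : H1 d) (t : ℝ) : E d := γ (projIcc 0 1 zero_le_one t)

/-- The extension of the derivative of a curve to the real line. -/
def H1.derivExt (γ : H1 d) (t : ℝ) : E d := γ.deriv (projIcc 0 1 zero_le_one t)

lemma H1.ext_coe (γ : H1 d) (t : unitInterval) : γ.ext t = γ t := by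
  rw [H1.ext, projIcc_val]

lemma H1.derivExt_coe (γ : H1 d) (t : unitInterval) : γ.derivExt t = γ.deriv t := by
  rw [H1.derivExt, projIcc_val]

lemma H1.intervalIntegrable_derivExt (γ : H1 d) : IntervalIntegrable γ.derivExt volume 0 1 := by
  rw [intervalIntegrable_iff_integrableOn_Icc_of_le zero_le_one]
  refine (unitInterval.measurePreserving_coe.integrable_comp_emb
    unitInterval.measurableEmbedding_coe).1 ?_
  refine (integrable_of_Lp γ.deriv).congr (ae_of_all _ fun t => ?_)
  exact (γ.derivExt_coe t).symm

lemma H1.ext_eq (γ : H1 d) {t : ℝ} (ht : t ∈ Icc (0 : ℝ) 1) :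
    γ.ext t = γ 0 + ∫ s in (0 : ℝ)..t, γ.derivExt s := by
  have h := γ.apply_eq ⟨t, ht⟩
  rw [H1.ext, projIcc_of_mem _ ht, h]
  congr 1
  have h1 := unitInterval.measurePreserving_coe.setIntegral_preimage_emb
    unitInterval.measurableEmbedding_coe γ.derivExt (Iic t)
  have h2 : ((↑) : unitInterval → ℝ) ⁻¹' Iic t = Iic ⟨t, ht⟩ := by
    ext s
    simp [← Subtype.coe_le_coe]
  have h3 : Iic t ∩ unitInterval = Icc 0 t := by
    ext s
    simp only [mem_inter_iff, mem_Iic, mem_Icc]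
    exact ⟨fun h => ⟨h.2.1, h.1⟩, fun h => ⟨h.2, h.1, h.2.trans ht.2⟩⟩
  rw [Measure.restrict_restrict measurableSet_Iic, h3, integral_Icc_eq_integral_Ioc,
    ← intervalIntegral.integral_of_le ht.1, h2] at h1
  rw [← h1]
  simp only [H1.derivExt_coe]

lemma H1.ae_hasDerivAt (γ : H1 d) :
    ∀ᵐ x : ℝ, x ∈ Ioo (0 : ℝ) 1 → HasDerivAt γ.ext (γ.derivExt x) x := by
  filter_upwards [γ.intervalIntegrable_derivExt.ae_hasDerivAt_integral] with x hx hx1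
  rw [uIcc_of_le zero_le_one] at hx
  have h := (hx (Ioo_subset_Icc_self hx1) 0 (by simp)).const_add (γ 0)
  refine h.congr_of_eventuallyEq ?_
  filter_upwards [Ioo_mem_nhds hx1.1 hx1.2] with y hy
  exact γ.ext_eq (Ioo_subset_Icc_self hy)

lemma ae_dt {p : ℝ → Prop} (h : ∀ᵐ x : ℝ, x ∈ Ioo (0 : ℝ) 1 → p x) :
    ∀ᵐ t : Ioo (0 : ℝ) 1 ∂dt, p t := by
  have h1 : ∀ᵐ x ∂(dt.map ((↑) : Ioo (0 : ℝ) 1 → ℝ)), p x := by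
    rw [dt, map_comap_subtype_coe measurableSet_Ioo]
    exact (ae_restrict_iff' measurableSet_Ioo).2 h
  exact ae_of_ae_map measurable_subtype_coe.aemeasurable h1

/-- The isolated points form a discrete subspace of the line, and a separable discrete space is
countable. -/
lemma countable_isolated {s : Set ℝ} : {x ∈ s | ∀ᶠ y in 𝓝[≠] x, y ∉ s}.Countable := by
  set A := {x ∈ s | ∀ᶠ y in 𝓝[≠] x, y ∉ s} with hA
  have : DiscreteTopology A := by
    rw [discreteTopology_subtype_iff]
    intro x hx
    rw [← Filter.empty_mem_iff_bot, mem_inf_principal]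
    filter_upwards [hx.2] with y hy hyA
    exact hy hyA.1
  exact (TopologicalSpace.separableSpace_iff_countable (α := A)).1 inferInstance

/-- Two curves have the same derivative almost everywhere on the set where they agree. -/
lemma H1.ae_deriv_eq (γ η : H1 d) :
    ∀ᵐ t ∂dt, γ (incl t) = η (incl t) → γ.deriv (incl t) = η.deriv (incl t) := by
  have h : ∀ᵐ x : ℝ, x ∈ Ioo (0 : ℝ) 1 → γ.ext x = η.ext x → γ.derivExt x = η.derivExt x := by
    have hc := (countable_isolated (s := {x | γ.ext x = η.ext x})).ae_notMem
      (volume : Measure ℝ)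
    filter_upwards [γ.ae_hasDerivAt, η.ae_hasDerivAt, hc] with x h1 h2 h3 hx hxe
    by_contra hne
    -- If the derivatives differed, the difference of the curves would be nonzero in a punctured
    -- neighbourhood, making `x` an isolated coincidence time.
    have h4 := ((h1 hx).sub (h2 hx)).eventually_ne (c := 0) (sub_ne_zero.2 hne)
    refine h3 ⟨hxe, ?_⟩
    filter_upwards [h4] with y hy hy'
    exact hy (sub_eq_zero.2 hy')
  filter_upwards [ae_dt h] with t ht
  have e : (t : ℝ) = (incl t : ℝ) := rfl
  rw [e, γ.ext_coe, η.ext_coe, γ.derivExt_coe, η.derivExt_coe] at ht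
  exact ht

end Derivative

/-! ### Absolute continuity and the chain rule along a curve -/

section ChainRule

variable {d : ℕ}

lemma AbsolutelyContinuousOnInterval.of_dist_le {X Y : Type*} [PseudoMetricSpace X]
    [PseudoMetricSpace Y] {f : ℝ → X} {g : ℝ → Y} {a b : ℝ} {K : ℝ}
    (hf : AbsolutelyContinuousOnInterval f a b)
    (h : ∀ x ∈ uIcc a b, ∀ y ∈ uIcc a b, dist (g x) (g y) ≤ K * dist (f x) (f y)) :
    AbsolutelyContinuousOnInterval g a b := by
  unfold AbsolutelyContinuousOnInterval at *
  have h0 := hf.const_mul K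
  rw [mul_zero] at h0
  refine squeeze_zero' (Eventually.of_forall fun E => Finset.sum_nonneg fun _ _ => dist_nonneg) ?_ h0
  refine eventually_inf_principal.2 (Eventually.of_forall fun E hE => ?_)
  rw [Finset.mul_sum]
  exact Finset.sum_le_sum fun i hi => h _ (hE.1 i hi).1 _ (hE.1 i hi).2

lemma H1.dist_ext_le (γ : H1 d) {s t : ℝ} (hs : s ∈ Icc (0 : ℝ) 1) (ht : t ∈ Icc (0 : ℝ) 1) :
    dist (γ.ext s) (γ.ext t) ≤
      |(∫ x in (0 : ℝ)..s, ‖γ.derivExt x‖) - ∫ x in (0 : ℝ)..t, ‖γ.derivExt x‖| := by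
  have hi : ∀ {a b}, a ∈ Icc (0 : ℝ) 1 → b ∈ Icc (0 : ℝ) 1 →
      IntervalIntegrable γ.derivExt volume a b := fun ha hb =>
    γ.intervalIntegrable_derivExt.mono_set (by
      rw [uIcc_of_le zero_le_one]; exact uIcc_subset_Icc ha hb)
  have h0 : (0 : ℝ) ∈ Icc (0 : ℝ) 1 := by simp
  rw [γ.ext_eq hs, γ.ext_eq ht, dist_add_left, dist_eq_norm,
    intervalIntegral.integral_interval_sub_left (hi h0 hs) (hi h0 ht),
    intervalIntegral.integral_interval_sub_left (hi h0 hs).norm (hi h0 ht).norm]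
  exact intervalIntegral.norm_integral_le_abs_integral_norm

/-- The increments of `t + ∫₀ᵗ ‖γ'‖`, which is absolutely continuous, dominate those of `(t, γ(t))`;
`φ` enlarges them by at most the factor `K`. -/
lemma H1.absolutelyContinuous_comp (γ : H1 d) {φ : ℝ × E d → ℝ} {K : ℝ≥0}
    (hφ : LipschitzWith K φ) :
    AbsolutelyContinuousOnInterval (fun t => φ (t, γ.ext t)) 0 1 := by
  have h1 : AbsolutelyContinuousOnInterval (fun t => ∫ x in (0 : ℝ)..t, ‖γ.derivExt x‖) 0 1 :=
    γ.intervalIntegrable_derivExt.norm.absolutelyContinuousOnInterval_intervalIntegral (by simp)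
  have h2 : AbsolutelyContinuousOnInterval (fun t : ℝ => t) 0 1 :=
    (LipschitzWith.id.lipschitzOnWith).absolutelyContinuousOnInterval
  have hi : ∀ {a b}, a ∈ Icc (0 : ℝ) 1 → b ∈ Icc (0 : ℝ) 1 →
      IntervalIntegrable (fun x => ‖γ.derivExt x‖) volume a b := fun ha hb =>
    γ.intervalIntegrable_derivExt.norm.mono_set (by
      rw [uIcc_of_le zero_le_one]; exact uIcc_subset_Icc ha hb)
  refine AbsolutelyContinuousOnInterval.of_dist_le (K := K) (h2.add h1) fun s hs t ht => ?_
  rw [uIcc_of_le zero_le_one] at hs ht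
  refine (hφ.dist_le_mul _ _).trans (mul_le_mul_of_nonneg_left ?_ K.2)
  wlog hst : t ≤ s generalizing s t
  · rw [dist_comm, dist_comm (((fun t : ℝ => t) + _) s)]
    exact this t ht s hs (le_of_not_ge hst)
  have h3 := γ.dist_ext_le hs ht
  have h0 : (0 : ℝ) ∈ Icc (0 : ℝ) 1 := by simp
  have h4 : 0 ≤ (∫ x in (0 : ℝ)..s, ‖γ.derivExt x‖) - ∫ x in (0 : ℝ)..t, ‖γ.derivExt x‖ := by
    rw [intervalIntegral.integral_interval_sub_left (hi h0 hs) (hi h0 ht)]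
    exact intervalIntegral.integral_nonneg hst fun _ _ => norm_nonneg _
  rw [abs_of_nonneg h4] at h3
  simp only [Pi.add_apply]
  rw [Prod.dist_eq, Real.dist_eq (s + _), abs_of_nonneg (by linarith)]
  refine max_le ?_ ?_
  · rw [Real.dist_eq, abs_of_nonneg (by simpa using hst)]
    linarith
  · simp only at h3 ⊢
    linarith

/-- The integrated chain rule along a curve, for test functions compactly supported in time. -/
lemma integral_chain_rule (γ : H1 d) {φ : ℝ × E d → ℝ} (hφ : ContDiff ℝ ∞ φ)
    (hc : HasCompactSupport φ) (hs : tsupport φ ⊆ Ioo (0 : ℝ) 1 ×ˢ (univ : Set (E d))) :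
    ∫ t, (deriv (fun s : ℝ => φ (s, γ (incl t))) (t : ℝ)
      + ⟪gradient (fun y : E d => φ ((t : ℝ), y)) (γ (incl t)), γ.deriv (incl t)⟫) ∂dt = 0 := by
  obtain ⟨K, hK⟩ := hφ.lipschitzWith_of_hasCompactSupport hc (by simp)
  have hac := γ.absolutelyContinuous_comp hK
  -- The fundamental theorem of calculus leaves boundary values at times 0 and 1, both outside the
  -- support of `φ`.
  have h1 := hac.integral_deriv_eq_sub
  have h0 : ∀ t : ℝ, t ∉ Ioo (0 : ℝ) 1 → ∀ y, φ (t, y) = 0 := fun t ht y =>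
    image_eq_zero_of_notMem_tsupport fun h => ht (hs h).1
  rw [h0 1 (by simp), h0 0 (by simp), sub_zero] at h1
  rw [intervalIntegral.integral_of_le zero_le_one, integral_Ioc_eq_integral_Ioo,
    ← integral_subtype_comap measurableSet_Ioo] at h1
  refine Eq.trans (integral_congr_ae ?_) h1
  filter_upwards [ae_dt γ.ae_hasDerivAt] with t ht
  have hd : DifferentiableAt ℝ φ ((t : ℝ), γ.ext t) := hφ.differentiable (by simp) _
  have e1 : γ (incl t) = γ.ext t := (γ.ext_coe (incl t)).symm
  have e2 : γ.deriv (incl t) = γ.derivExt t := (γ.derivExt_coe (incl t)).symm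
  rw [e1, e2]
  -- The total derivative along the curve, the partial derivative in time and the partial derivative
  -- in space all come from the same Fréchet derivative, so linearity relates them.
  have hA := hd.hasFDerivAt.comp_hasDerivAt (t : ℝ) ((hasDerivAt_id (t : ℝ)).prodMk ht)
  have hB := hd.hasFDerivAt.comp_hasDerivAt (t : ℝ)
    ((hasDerivAt_id (t : ℝ)).prodMk (hasDerivAt_const (t : ℝ) (γ.ext t)))
  have hC := hd.hasFDerivAt.comp (γ.ext t)
    ((hasFDerivAt_const (t : ℝ) (γ.ext t)).prodMk (hasFDerivAt_id (γ.ext t)))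
  have hA' := hA.deriv
  have hB' := hB.deriv
  have hC' := hC.fderiv
  simp only [Function.comp_def, id] at hA' hB' hC'
  rw [hA', hB', gradient, InnerProductSpace.toDual_symm_apply, hC']
  simp only [ContinuousLinearMap.comp_apply, ContinuousLinearMap.prod_apply]
  rw [← map_add]
  simp

end ChainRule

/-! ### Integration against vector measures with a density -/

section VectorIntegrals

variable {X : Type*} [MeasurableSpace X]

lemma isFiniteMeasure_variation_withDensityᵥ {F : Type*} [NormedAddCommGroup F] [NormedSpace ℝ F]
    [CompleteSpace F] {μ : Measure X} {v : X → F} (hv : Integrable v μ) :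
    IsFiniteMeasure (μ.withDensityᵥ v).variation := by
  rw [Measure.variation_withDensityᵥ hv]
  exact isFiniteMeasure_withDensity hv.2.ne

lemma integral_signed {μ : Measure X} [IsFiniteMeasure μ] (f : X → ℝ) :
    ∫ᵛ x, f x ∂•μ.toSignedMeasure = ∫ x, f x ∂μ := by
  rw [← VectorMeasure.integral_toSignedMeasure]
  congr 1
  ext
  simp

lemma integral_withDensityᵥ_simpleFunc {F : Type*} [NormedAddCommGroup F] [NormedSpace ℝ F]
    [CompleteSpace F] {G : Type*} [NormedAddCommGroup G] [NormedSpace ℝ G] [CompleteSpace G]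
    {E' : Type*} [NormedAddCommGroup E'] [NormedSpace ℝ E'] {μ : Measure X} {v : X → F}
    (hv : Integrable v μ) (B : E' →L[ℝ] F →L[ℝ] G) (s : SimpleFunc X E') :
    ∫ᵛ x, s x ∂[B; μ.withDensityᵥ v] = ∫ x, B (s x) (v x) ∂μ := by
  have := isFiniteMeasure_variation_withDensityᵥ hv
  have hint : ∀ f : SimpleFunc X E', Integrable (fun x => B (f x) (v x)) μ := by
    intro f
    obtain ⟨C, hC⟩ := f.exists_forall_norm_le
    refine Integrable.mono' (hv.norm.const_mul (‖B‖ * C)) ?_ (ae_of_all _ fun x => ?_)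
    · exact B.aestronglyMeasurable_comp₂ f.aestronglyMeasurable hv.1
    · refine (B.le_opNorm₂ _ _).trans ?_
      gcongr
      exact hC x
  induction s using SimpleFunc.induction with
  | @const c A hA =>
    have e : ∀ x, B ((SimpleFunc.piecewise A hA (SimpleFunc.const X c) (SimpleFunc.const X 0)) x)
        (v x) = A.indicator (fun x => B c (v x)) x := by
      intro x
      by_cases hx : x ∈ A <;> simp [hx]
    simp_rw [e]
    rw [integral_indicator hA, ContinuousLinearMap.integral_comp_comm _ hv.integrableOn,
      ← withDensityᵥ_apply hv hA]
    have e2 : ∀ x, (SimpleFunc.piecewise A hA (SimpleFunc.const X c) (SimpleFunc.const X 0)) x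
        = A.indicator (fun _ => c) x := by
      intro x
      by_cases hx : x ∈ A <;> simp [hx]
    simp_rw [e2]
    rw [VectorMeasure.integral_indicator hA]
    simp
  | @add f g _ hf hg =>
    have h1 : (μ.withDensityᵥ v).Integrable f := f.integrable_of_isFiniteMeasure
    have h2 : (μ.withDensityᵥ v).Integrable g := g.integrable_of_isFiniteMeasure
    simp only [SimpleFunc.coe_add, Pi.add_apply, map_add, add_apply]
    rw [VectorMeasure.integral_fun_add h1 h2, hf, hg, integral_add (hint f) (hint g)]

/-- Bounded simple functions approximate `f` pointwise. Dominated convergence applies on both sides: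
with a constant on the left, since the variation is finite, and with a multiple of `‖v‖` on the
right. -/
lemma integral_withDensityᵥ {F : Type*} [NormedAddCommGroup F] [NormedSpace ℝ F]
    [CompleteSpace F] {G : Type*} [NormedAddCommGroup G] [NormedSpace ℝ G] [CompleteSpace G]
    {E' : Type*} [NormedAddCommGroup E'] [NormedSpace ℝ E'] {μ : Measure X} {v : X → F}
    (hv : Integrable v μ) (B : E' →L[ℝ] F →L[ℝ] G) {f : X → E'} (hf : StronglyMeasurable f)
    {C : ℝ} (hC : ∀ x, ‖f x‖ ≤ C) :
    ∫ᵛ x, f x ∂[B; μ.withDensityᵥ v] = ∫ x, B (f x) (v x) ∂μ := by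
  have := isFiniteMeasure_variation_withDensityᵥ hv
  have hb : ∀ n x, ‖hf.approxBounded C n x‖ ≤ C := fun n x =>
    hf.norm_approxBounded_le ((norm_nonneg _).trans (hC x)) n x
  have hl : ∀ x, Tendsto (fun n => hf.approxBounded C n x) atTop (𝓝 (f x)) := fun x =>
    hf.tendsto_approxBounded_of_norm_le (hC x)
  have h1 : Tendsto (fun n => ∫ᵛ x, hf.approxBounded C n x ∂[B; μ.withDensityᵥ v]) atTop
      (𝓝 (∫ᵛ x, f x ∂[B; μ.withDensityᵥ v])) :=
    VectorMeasure.tendsto_integral_of_dominated_convergence (fun _ => C)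
      (fun n => (hf.approxBounded C n).aestronglyMeasurable) (integrable_const C)
      (fun n => ae_of_all _ (hb n)) (ae_of_all _ hl)
  have h2 : Tendsto (fun n => ∫ x, B (hf.approxBounded C n x) (v x) ∂μ) atTop
      (𝓝 (∫ x, B (f x) (v x) ∂μ)) := by
    refine tendsto_integral_of_dominated_convergence (fun x => ‖B‖ * C * ‖v x‖)
      (fun n => B.aestronglyMeasurable_comp₂ (hf.approxBounded C n).aestronglyMeasurable hv.1)
      (hv.norm.const_mul _) (fun n => ae_of_all _ fun x => ?_) (ae_of_all _ fun x => ?_)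
    · refine (B.le_opNorm₂ _ _).trans ?_
      gcongr
      exact hb n x
    · exact ((B.flip (v x)).continuous.tendsto _).comp (hl x)
  simp_rw [integral_withDensityᵥ_simpleFunc hv B] at h1
  exact tendsto_nhds_unique h1 h2

end VectorIntegrals

/-! ### The Benamou–Brenier energy of a measure with a velocity field -/

section Energy

variable {d : ℕ} {Ω : Set (E d)}

lemma component_withDensityᵥ {X : Type*} [MeasurableSpace X] {ν : Measure X} {v : X → E d}
    (hv : Integrable v ν) (i : Fin d) :
    component (ν.withDensityᵥ v) i = ν.withDensityᵥ fun x => v x i := by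
  have hi : Integrable (fun x => v x i) ν :=
    (EuclideanSpace.proj (𝕜 := ℝ) i : E d →L[ℝ] ℝ).integrable_comp hv
  ext A hA
  have h : component (ν.withDensityᵥ v) i A = (EuclideanSpace.proj (𝕜 := ℝ) i : E d →L[ℝ] ℝ)
    (ν.withDensityᵥ v A) := rfl
  rw [withDensityᵥ_apply hi hA, h, withDensityᵥ_apply hv hA]
  exact ((EuclideanSpace.proj (𝕜 := ℝ) i : E d →L[ℝ] ℝ).integral_comp_comm hv.integrableOn).symm

lemma Psi_smul {s : ℝ} (hs : 0 < s) (x : E d) :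
    Psi s (s • x) = ENNReal.ofReal (s * (‖x‖ ^ 2 / 2)) := by
  rw [Psi, if_pos hs, norm_smul, Real.norm_of_nonneg hs.le]
  congr 1
  field_simp

lemma toSignedMeasure_eq_withDensityᵥ_one {X : Type*} [MeasurableSpace X] (ν : Measure X)
    [IsFiniteMeasure ν] : ν.toSignedMeasure = ν.withDensityᵥ fun _ => (1 : ℝ) := by
  ext A hA
  rw [withDensityᵥ_apply (integrable_const _) hA, Measure.toSignedMeasure_apply_measurable hA]
  simp

/-- Since `f ν = (f / h) (h ν)`, uniqueness of the Lebesgue decomposition with zero singular part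
identifies the density. -/
lemma rnDeriv_withDensityᵥ {X : Type*} [MeasurableSpace X] {ν : Measure X} {h : X → ℝ}
    (hm : Measurable h) (h1 : ∀ x, 0 < h x) [IsFiniteMeasure ν] {f : X → ℝ}
    (hf : Integrable f ν) :
    (fun x => (h x)⁻¹ * f x) =ᵐ[ν.withDensity fun x => ENNReal.ofReal (h x)]
      SignedMeasure.rnDeriv (ν.withDensityᵥ f) (ν.withDensity fun x => ENNReal.ofReal (h x)) := by
  have e : (fun x => (ENNReal.ofReal (h x)).toReal • ((h x)⁻¹ * f x)) = f := by
    funext x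
    rw [ENNReal.toReal_ofReal (h1 x).le, smul_eq_mul, mul_inv_cancel_left₀ (h1 x).ne']
  have h2 : ν.withDensityᵥ f = (ν.withDensity fun x => ENNReal.ofReal (h x)).withDensityᵥ
      fun x => (h x)⁻¹ * f x := by
    rw [← withDensityᵥ_smul_eq_withDensityᵥ_withDensity' hm.ennreal_ofReal.aemeasurable
      (ae_of_all _ fun _ => ENNReal.ofReal_lt_top) (by rw [e]; exact hf), e]
  refine SignedMeasure.eq_rnDeriv 0 _ ?_ (VectorMeasure.MutuallySingular.zero_left) ?_
  · rw [integrable_withDensity_iff_integrable_smul' hm.ennreal_ofReal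
      (ae_of_all _ fun _ => ENNReal.ofReal_lt_top), e]
    exact hf
  · rw [zero_add, h2]

/-- The Benamou-Brenier energy of a measure with a given velocity field. -/
lemma benamouBrenier_eq {ν : Measure (Cylinder Ω)} [IsFiniteMeasure ν] {v : Cylinder Ω → E d}
    (hm : Measurable v) (hv : Integrable v ν) :
    benamouBrenier (ν.toSignedMeasure, ν.withDensityᵥ v)
      = ∫⁻ p, ENNReal.ofReal (‖v p‖ ^ 2 / 2) ∂ν := by
  have hi : ∀ i, Integrable (fun x => v x i) ν := fun i =>
    (EuclideanSpace.proj (𝕜 := ℝ) i : E d →L[ℝ] ℝ).integrable_comp hv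
  have hmi : ∀ i, Measurable fun x => v x i := fun i =>
    (EuclideanSpace.proj (𝕜 := ℝ) i : E d →L[ℝ] ℝ).continuous.measurable.comp hm
  -- This is the density of `refMeasure` with respect to `ν`. The summand 1 comes from the variation
  -- of the mass and keeps `h` positive, so both densities can be divided by it; one-homogeneity of
  -- `Psi` then cancels `h`.
  let h : Cylinder Ω → ℝ := fun x => 1 + ∑ i, ‖v x i‖
  have hh : Measurable h := measurable_const.add (Finset.measurable_sum _ fun i _ => (hmi i).norm)
  have hpos : ∀ x, 0 < h x := fun x => by positivity
  have href : refMeasure (ν.toSignedMeasure, ν.withDensityᵥ v)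
      = ν.withDensity fun x => ENNReal.ofReal (h x) := by
    have e : (fun x => ENNReal.ofReal (h x)) = (1 : Cylinder Ω → ℝ≥0∞) + ∑ i, fun x => ‖v x i‖ₑ := by
      funext x
      simp only [h, Pi.add_apply, Pi.one_apply, Finset.sum_apply]
      rw [ENNReal.ofReal_add zero_le_one (by positivity), ENNReal.ofReal_one,
        ENNReal.ofReal_sum_of_nonneg fun _ _ => norm_nonneg _]
      simp_rw [ofReal_norm]
    rw [e, withDensity_add_left measurable_one, withDensity_one, refMeasure,
      Measure.variation_toSignedMeasure]
    congr 1
    have e2 : (∑ i, fun x => ‖v x i‖ₑ) = fun x => ∑ i : Fin d, ‖v x i‖ₑ := by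
      funext x
      simp
    rw [e2]
    ext A hA
    rw [withDensity_apply _ hA, lintegral_finsetSum _ fun i _ => (hmi i).enorm]
    simp only [Measure.coe_finsetSum, Finset.sum_apply]
    refine Finset.sum_congr rfl fun i _ => ?_
    rw [component_withDensityᵥ hv, Measure.variation_withDensityᵥ (hi i), withDensity_apply _ hA]
  rw [benamouBrenier, href]
  have h0 := rnDeriv_withDensityᵥ hh hpos (integrable_const (μ := ν) (1 : ℝ))
  have hi' := fun i => rnDeriv_withDensityᵥ hh hpos (hi i)
  rw [← toSignedMeasure_eq_withDensityᵥ_one] at h0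
  have hcong : ∀ᵐ p ∂(ν.withDensity fun x => ENNReal.ofReal (h x)),
      Psi (ν.toSignedMeasure.rnDeriv (ν.withDensity fun x => ENNReal.ofReal (h x)) p)
        (WithLp.toLp 2 fun i => (component (ν.withDensityᵥ v) i).rnDeriv
          (ν.withDensity fun x => ENNReal.ofReal (h x)) p : E d)
      = ENNReal.ofReal ((h p)⁻¹ * (‖v p‖ ^ 2 / 2)) := by
    filter_upwards [h0, ae_all_iff.2 hi'] with p hp hpi
    have e : (WithLp.toLp 2 fun i => (component (ν.withDensityᵥ v) i).rnDeriv
          (ν.withDensity fun x => ENNReal.ofReal (h x)) p : E d) = (h p)⁻¹ • v p := by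
      ext i
      simp only [component_withDensityᵥ hv, ← hpi, PiLp.smul_apply, smul_eq_mul]
    rw [e, ← hp, mul_one, Psi_smul (inv_pos.2 (hpos p))]
  rw [lintegral_congr_ae hcong, lintegral_withDensity_eq_lintegral_mul _ hh.ennreal_ofReal (by
    fun_prop)]
  refine lintegral_congr fun p => ?_
  rw [Pi.mul_apply, ← ENNReal.ofReal_mul (hpos p).le, mul_inv_cancel_left₀ (hpos p).ne']

end Energy

/-! ### Superpositions of curves and their common velocity -/

section TupleMeasure

variable {d : ℕ} {Ω : Set (E d)} {N : ℕ}

lemma measurable_graph (γ : H1In Ω) :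
    Measurable fun t : Ioo (0 : ℝ) 1 => (t, γ.pos (incl t)) := by
  refine measurable_id.prodMk (Measurable.subtype_mk ?_)
  exact γ.1.curve.continuous.measurable.comp measurePreserving_incl.measurable

lemma stronglyMeasurable_deriv_fst (γ : H1In Ω) :
    StronglyMeasurable fun p : Cylinder Ω => γ.1.deriv (incl p.1) :=
  (Lp.stronglyMeasurable γ.1.deriv).comp_measurable
    (measurePreserving_incl.measurable.comp measurable_fst)

lemma integrable_deriv_graph (γ : H1In Ω) :
    Integrable (fun p : Cylinder Ω => γ.1.deriv (incl p.1)) (graphMeasure γ) := by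
  rw [graphMeasure, integrable_map_measure (stronglyMeasurable_deriv_fst γ).aestronglyMeasurable
    (measurable_graph γ).aemeasurable]
  exact measurePreserving_incl.integrable_comp_of_integrable (integrable_of_Lp γ.1.deriv)

lemma graphMeasure_univ (γ : H1In Ω) : graphMeasure γ univ = 1 := by
  rw [graphMeasure, Measure.map_apply (measurable_graph γ) MeasurableSet.univ, preimage_univ,
    ← preimage_univ (f := incl), measurePreserving_incl.measure_preimage
      MeasurableSet.univ.nullMeasurableSet]
  exact measure_univ

/-- The positive measure `∑ j, c_j a_{γ_j} dt ⊗ δ_{γ_j(t)}`. -/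
def tupleDensity (α β : ℝ) (c : Fin N → ℝ) (Γ : Fin N → H1In Ω) : Measure (Cylinder Ω) :=
  ∑ j, ENNReal.ofReal (c j * weight α β (Γ j).1) • graphMeasure (Γ j)

instance (α β : ℝ) (c : Fin N → ℝ) (Γ : Fin N → H1In Ω) :
    IsFiniteMeasure (tupleDensity α β c Γ) := by
  refine ⟨?_⟩
  simp only [tupleDensity, Measure.coe_finsetSum, Finset.sum_apply, Measure.smul_apply,
    graphMeasure_univ, smul_eq_mul, mul_one]
  exact ENNReal.sum_lt_top.2 fun _ _ => ENNReal.ofReal_lt_top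

open Classical in
/-- A common velocity field for the curves `γ_j`. -/
def tupleVelocity (Γ : Fin N → H1In Ω) (p : Cylinder Ω) : E d :=
  (∑ j, if (Γ j).pos (incl p.1) = p.2 then (1 : ℝ) else 0)⁻¹ •
    ∑ j, if (Γ j).pos (incl p.1) = p.2 then (Γ j).1.deriv (incl p.1) else 0

lemma measurable_tupleVelocity (Γ : Fin N → H1In Ω) : Measurable (tupleVelocity Γ) := by
  classical
  have h : ∀ j, MeasurableSet {p : Cylinder Ω | (Γ j).pos (incl p.1) = p.2} := fun j =>
    measurableSet_eq_fun ((measurable_graph (Γ j)).snd.comp measurable_fst) measurable_snd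
  unfold tupleVelocity
  refine Measurable.smul (f := fun p : Cylinder Ω => (∑ j, if (Γ j).pos (incl p.1) = p.2 then
    (1 : ℝ) else 0)⁻¹) (Measurable.inv (Finset.measurable_sum _ fun j _ => ?_))
    (Finset.measurable_sum _ fun j _ => ?_)
  · exact Measurable.ite (h j) measurable_const measurable_const
  · exact Measurable.ite (h j) (stronglyMeasurable_deriv_fst (Γ j)).measurable measurable_const

/-- The velocity averages the derivatives of the curves through a given point. On the graph of `γ_k`
the average is over a nonempty family, and by `H1.ae_deriv_eq` almost surely all its members equal
the derivative of `γ_k`. -/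
lemma tupleVelocity_ae_eq (Γ : Fin N → H1In Ω) (k : Fin N) :
    tupleVelocity Γ =ᵐ[graphMeasure (Γ k)] fun p => (Γ k).1.deriv (incl p.1) := by
  classical
  refine (ae_map_iff (measurable_graph (Γ k)).aemeasurable (measurableSet_eq_fun
    (measurable_tupleVelocity Γ) (stronglyMeasurable_deriv_fst (Γ k)).measurable)).2 ?_
  filter_upwards [ae_all_iff.2 fun j => (Γ j).1.ae_deriv_eq (Γ k).1] with t ht
  simp only [tupleVelocity]
  have e : ∀ j, (if (Γ j).pos (incl t) = (Γ k).pos (incl t) then (Γ j).1.deriv (incl t) else 0)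
      = (if (Γ j).pos (incl t) = (Γ k).pos (incl t) then (1 : ℝ) else 0) •
        (Γ k).1.deriv (incl t) := by
    intro j
    split_ifs with h
    · rw [one_smul]
      exact ht j (congrArg Subtype.val h)
    · rw [zero_smul]
  simp_rw [e]
  rw [← Finset.sum_smul, smul_smul, inv_mul_cancel₀, one_smul]
  have h1 := Finset.single_le_sum (f := fun j => if (Γ j).pos (incl t) = (Γ k).pos (incl t)
    then (1 : ℝ) else 0) (fun j _ => by split_ifs <;> norm_num) (Finset.mem_univ k)
  simp only [if_true] at h1
  exact (zero_lt_one.trans_le h1).ne'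

variable {α β : ℝ} {c : Fin N → ℝ}

lemma coeff_pos (hα : 0 < α) (hβ : 0 < β) (hc : ∀ j, 0 < c j) (Γ : Fin N → H1In Ω) (j : Fin N) : 0 < c j * weight α β (Γ j).1 :=
  mul_pos (hc j) (weight_pos hα hβ _)

lemma integrable_tupleVelocity (Γ : Fin N → H1In Ω) :
    Integrable (tupleVelocity Γ) (tupleDensity α β c Γ) := by
  refine integrable_finsetSum_measure.2 fun j _ => Integrable.smul_measure ?_ ENNReal.ofReal_ne_top
  exact (integrable_deriv_graph (Γ j)).congr (tupleVelocity_ae_eq Γ j).symm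

lemma tupleMeasure_fst (hα : 0 < α) (hβ : 0 < β) (hc : ∀ j, 0 < c j) (Γ : Fin N → H1In Ω) :
    (tupleMeasure α β c Γ).1 = (tupleDensity α β c Γ).toSignedMeasure := by
  ext A hA
  have e : (tupleMeasure α β c Γ).1
      = ∑ j, c j • weight α β (Γ j).1 • (graphMeasure (Γ j)).toSignedMeasure := by
    simp [tupleMeasure, curveMeasure, Prod.fst_sum]
  rw [e, Measure.toSignedMeasure_apply_measurable hA, tupleDensity, Measure.real]
  simp only [Measure.coe_finsetSum, Finset.sum_apply, Measure.smul_apply, smul_eq_mul]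
  rw [ENNReal.toReal_sum fun j _ => ENNReal.mul_ne_top ENNReal.ofReal_ne_top (measure_ne_top _ _)]
  simp only [FunLike.coe_sum, Finset.sum_apply, smul_apply, smul_eq_mul]
  refine Finset.sum_congr rfl fun j _ => ?_
  rw [Measure.toSignedMeasure_apply_measurable hA, ENNReal.toReal_mul,
    ENNReal.toReal_ofReal (coeff_pos hα hβ hc Γ j).le, mul_assoc]
  rfl

/-- On each graph the common velocity is the curve's own, so the momenta add up to one density
against the total mass. This puts the pair in the form required by `benamouBrenier_eq`, even if the
curves intersect. -/
lemma tupleMeasure_snd (hα : 0 < α) (hβ : 0 < β) (hc : ∀ j, 0 < c j) (Γ : Fin N → H1In Ω) :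
    (tupleMeasure α β c Γ).2 = (tupleDensity α β c Γ).withDensityᵥ (tupleVelocity Γ) := by
  ext1 A hA
  have e : (tupleMeasure α β c Γ).2 = ∑ j, c j • weight α β (Γ j).1 •
      (graphMeasure (Γ j)).withDensityᵥ fun p => (Γ j).1.deriv (incl p.1) := by
    simp [tupleMeasure, curveMeasure, Prod.snd_sum]
  rw [e, withDensityᵥ_apply (integrable_tupleVelocity Γ) hA]
  have hr : (tupleDensity α β c Γ).restrict A = ∑ j, ENNReal.ofReal (c j * weight α β (Γ j).1) •
      (graphMeasure (Γ j)).restrict A := by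
    ext B hB
    simp [tupleDensity, Measure.restrict_apply hB]
  rw [hr, integral_finsetSum_measure fun j _ => Integrable.smul_measure
    ((integrable_deriv_graph (Γ j)).congr (tupleVelocity_ae_eq Γ j).symm).integrableOn
    ENNReal.ofReal_ne_top]
  simp only [FunLike.coe_sum, Finset.sum_apply, smul_apply]
  refine Finset.sum_congr rfl fun j _ => ?_
  rw [withDensityᵥ_apply (integrable_deriv_graph (Γ j)) hA, integral_smul_measure,
    ENNReal.toReal_ofReal (coeff_pos hα hβ hc Γ j).le, mul_smul,
    integral_congr_ae (ae_restrict_of_ae (tupleVelocity_ae_eq Γ j))]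

end TupleMeasure

/-! ### The continuity equation and the value of the regularizer -/

section Regularizer

variable {d : ℕ} {Ω : Set (E d)} {N : ℕ} {α β : ℝ} {c : Fin N → ℝ}

lemma deriv_slice {φ : ℝ × E d → ℝ} (hφ : ContDiff ℝ ∞ φ) (t : ℝ) (y : E d) :
    deriv (fun s : ℝ => φ (s, y)) t = fderiv ℝ φ (t, y) (1, 0) := by
  have hd : DifferentiableAt ℝ φ (t, y) := hφ.differentiable (by simp) _
  exact (hd.hasFDerivAt.comp_hasDerivAt t
    ((hasDerivAt_id t).prodMk (hasDerivAt_const t y))).deriv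

lemma gradient_slice {φ : ℝ × E d → ℝ} (hφ : ContDiff ℝ ∞ φ) (t : ℝ) (y : E d) :
    gradient (fun z : E d => φ (t, z)) y = (InnerProductSpace.toDual ℝ (E d)).symm
      ((fderiv ℝ φ (t, y)).comp (ContinuousLinearMap.inr ℝ ℝ (E d))) := by
  have hd : DifferentiableAt ℝ φ (t, y) := hφ.differentiable (by simp) _
  have h := hd.hasFDerivAt.comp y ((hasFDerivAt_const t y).prodMk (hasFDerivAt_id y))
  rw [gradient]
  congr 1
  exact h.fderiv

/-- Pulling the integral back to the time axis turns it into `integral_chain_rule`. -/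
lemma integral_graphMeasure_test {γ : H1In Ω} {φ : ℝ × E d → ℝ} (hφ : ContDiff ℝ ∞ φ)
    (hc : HasCompactSupport φ) (hs : tsupport φ ⊆ Ioo (0 : ℝ) 1 ×ˢ (univ : Set (E d)))
    {v : Cylinder Ω → E d} (hv : v =ᵐ[graphMeasure γ] fun p => γ.1.deriv (incl p.1)) :
    ∫ p, (deriv (fun s : ℝ => φ (s, (p.2 : E d))) (p.1 : ℝ)
      + ⟪gradient (fun y : E d => φ ((p.1 : ℝ), y)) (p.2 : E d), v p⟫) ∂(graphMeasure γ) = 0 := by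
  refine Eq.trans ?_ (integral_chain_rule γ.1 hφ hc hs)
  have e : (fun p : Cylinder Ω => deriv (fun s : ℝ => φ (s, (p.2 : E d))) (p.1 : ℝ)
      + ⟪gradient (fun y : E d => φ ((p.1 : ℝ), y)) (p.2 : E d), v p⟫)
      =ᵐ[graphMeasure γ] fun p => fderiv ℝ φ ((p.1 : ℝ), (p.2 : E d)) (1, 0) +
        ⟪(InnerProductSpace.toDual ℝ (E d)).symm ((fderiv ℝ φ ((p.1 : ℝ), (p.2 : E d))).comp
          (ContinuousLinearMap.inr ℝ ℝ (E d))), γ.1.deriv (incl p.1)⟫ := by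
    filter_upwards [hv] with p hp
    rw [deriv_slice hφ, gradient_slice hφ, hp]
  have hcont : Continuous (fderiv ℝ φ) := hφ.continuous_fderiv (by simp)
  refine (integral_congr_ae e).trans ?_
  rw [graphMeasure, integral_map (measurable_graph γ).aemeasurable]
  · refine integral_congr_ae (ae_of_all _ fun t => ?_)
    simp only
    rw [deriv_slice hφ, gradient_slice hφ]
    rfl
  · refine AEStronglyMeasurable.add ?_ ?_
    · have : Continuous fun p : Cylinder Ω => fderiv ℝ φ ((p.1 : ℝ), (p.2 : E d)) (1, 0) := by
        fun_prop
      exact this.aestronglyMeasurable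
    · refine AEStronglyMeasurable.inner ?_ (stronglyMeasurable_deriv_fst γ).aestronglyMeasurable
      refine Continuous.aestronglyMeasurable ?_
      refine (LinearIsometryEquiv.continuous _).comp ?_
      fun_prop

lemma tupleMeasure_continuityEq (hα : 0 < α) (hβ : 0 < β) (hc : ∀ j, 0 < c j)
    (Γ : Fin N → H1In Ω) : ContinuityEq (tupleMeasure α β c Γ) := by
  intro φ hφ hcs hs
  rw [tupleMeasure_fst hα hβ hc, tupleMeasure_snd hα hβ hc]
  obtain ⟨K, hK⟩ := hφ.lipschitzWith_of_hasCompactSupport hcs (by simp)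
  have hcont : Continuous (fderiv ℝ φ) := hφ.continuous_fderiv (by simp)
  have hb : ∀ x, ‖fderiv ℝ φ x‖ ≤ K := fun x => norm_fderiv_le_of_lipschitz ℝ hK
  have hv := integrable_tupleVelocity (α := α) (β := β) (c := c) Γ
  set g : Cylinder Ω → E d := fun p => gradient (fun y : E d => φ ((p.1 : ℝ), y)) (p.2 : E d)
    with hg
  set f : Cylinder Ω → ℝ := fun p => deriv (fun s : ℝ => φ (s, (p.2 : E d))) (p.1 : ℝ) with hf
  have hgm : StronglyMeasurable g := by
    refine Continuous.stronglyMeasurable ?_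
    simp only [hg, gradient_slice hφ]
    refine (LinearIsometryEquiv.continuous _).comp ?_
    fun_prop
  have hgb : ∀ p, ‖g p‖ ≤ K := by
    intro p
    simp only [hg, gradient_slice hφ, LinearIsometryEquiv.norm_map]
    refine (ContinuousLinearMap.opNorm_comp_le _ _).trans ?_
    exact (mul_le_of_le_one_right (norm_nonneg _)
      (ContinuousLinearMap.norm_inr_le_one ℝ ℝ (E d))).trans (hb _)
  have hfm : Continuous f := by
    simp only [hf, deriv_slice hφ]
    fun_prop
  have hfb : ∀ p, ‖f p‖ ≤ K := by
    intro p
    simp only [hf, deriv_slice hφ]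
    refine (ContinuousLinearMap.le_opNorm _ _).trans ?_
    have : ‖((1 : ℝ), (0 : E d))‖ = 1 := by simp [Prod.norm_def]
    rw [this, mul_one]
    exact hb _
  have hfi : Integrable f (tupleDensity α β c Γ) :=
    Integrable.of_bound hfm.aestronglyMeasurable K (ae_of_all _ hfb)
  have hgi : Integrable (fun p => ⟪g p, tupleVelocity Γ p⟫) (tupleDensity α β c Γ) := by
    refine Integrable.mono' (hv.norm.const_mul K) (hgm.aestronglyMeasurable.inner hv.1)
      (ae_of_all _ fun p => ?_)
    exact (norm_inner_le_norm _ _).trans (mul_le_mul_of_nonneg_right (hgb p) (norm_nonneg _))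
  rw [integral_signed, integral_withDensityᵥ hv _ hgm hgb]
  change ∫ p, f p ∂_ + ∫ p, ⟪g p, tupleVelocity Γ p⟫ ∂_ = 0
  rw [← integral_add hfi hgi, tupleDensity, integral_finsetSum_measure]
  · refine Finset.sum_eq_zero fun j _ => ?_
    rw [integral_smul_measure, integral_graphMeasure_test hφ hcs hs (tupleVelocity_ae_eq Γ j),
      smul_zero]
  · exact integrable_finsetSum_measure.1 (hfi.add hgi)

lemma lintegral_deriv_sq (γ : H1 d) :
    ∫⁻ t, ENNReal.ofReal (‖γ.deriv t‖ ^ 2 / 2) = ENNReal.ofReal ((∫ t, ‖γ.deriv t‖ ^ 2) / 2) := by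
  rw [← integral_div, ofReal_integral_eq_lintegral_ofReal]
  · exact (Lp.memLp γ.deriv).integrable_norm_pow (by norm_num) |>.div_const 2
  · exact ae_of_all _ fun _ => by positivity

/-- Energy and mass are both integrals over the sum of the graph measures. Curve by curve they
combine to `c_j a_{γ_j} L(γ_j)`, and the weight is the inverse of `L`. The result does not depend on
the curves. -/
lemma regularizer_tupleMeasure (hα : 0 < α) (hβ : 0 < β) (hc : ∀ j, 0 < c j)
    (Γ : Fin N → H1In Ω) :
    regularizer α β (tupleMeasure α β c Γ) = ENNReal.ofReal (∑ j, c j) := by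
  rw [regularizer, if_pos (tupleMeasure_continuityEq hα hβ hc Γ)]
  have e : tupleMeasure α β c Γ = ((tupleDensity α β c Γ).toSignedMeasure,
      (tupleDensity α β c Γ).withDensityᵥ (tupleVelocity Γ)) :=
    Prod.ext (tupleMeasure_fst hα hβ hc Γ) (tupleMeasure_snd hα hβ hc Γ)
  rw [e, benamouBrenier_eq (measurable_tupleVelocity Γ) (integrable_tupleVelocity Γ)]
  simp only [Measure.variation_toSignedMeasure]
  have h1 : ∀ j, ∫⁻ p, ENNReal.ofReal (‖tupleVelocity Γ p‖ ^ 2 / 2) ∂(graphMeasure (Γ j))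
      = ENNReal.ofReal ((∫ t, ‖(Γ j).1.deriv t‖ ^ 2) / 2) := by
    intro j
    have hm : Measurable fun t => ENNReal.ofReal (‖(Γ j).1.deriv t‖ ^ 2 / 2) :=
      (((Lp.stronglyMeasurable (Γ j).1.deriv).measurable.norm.pow_const 2).div_const 2).ennreal_ofReal
    rw [← lintegral_deriv_sq, ← measurePreserving_incl.lintegral_comp hm, lintegral_congr_ae
      ((tupleVelocity_ae_eq Γ j).mono fun p hp => by simp only at hp; rw [hp]), graphMeasure,
      lintegral_map _ (measurable_graph (Γ j))]
    exact hm.comp (measurePreserving_incl.measurable.comp measurable_fst)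
  rw [tupleDensity, lintegral_finsetSum_measure]
  simp only [lintegral_smul_measure, h1, Measure.coe_finsetSum, Finset.sum_apply,
    Measure.smul_apply, graphMeasure_univ, smul_eq_mul, mul_one, Finset.mul_sum]
  rw [← Finset.sum_add_distrib, ENNReal.ofReal_sum_of_nonneg fun j _ => (hc j).le]
  refine Finset.sum_congr rfl fun j _ => ?_
  have hp := coeff_pos hα hβ hc Γ j
  have hI : 0 ≤ ∫ t, ‖(Γ j).1.deriv t‖ ^ 2 := integral_nonneg fun _ => by positivity
  rw [← ENNReal.ofReal_mul hp.le, ← ENNReal.ofReal_mul hβ.le, ← ENNReal.ofReal_mul hα.le,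
    ← ENNReal.ofReal_add (by positivity) (by positivity)]
  congr 1
  have hl : len α β (Γ j).1 ≠ 0 := (hα.trans_le (le_len hβ _)).ne'
  have : β * (c j * weight α β (Γ j).1 * ((∫ t, ‖(Γ j).1.deriv t‖ ^ 2) / 2))
      + α * (c j * weight α β (Γ j).1) = c j * ((len α β (Γ j).1)⁻¹ * len α β (Γ j).1) := by
    rw [weight, len]
    ring
  rw [this, inv_mul_cancel₀ hl, mul_one]

end Regularizer

/-! ### Disintegration in time and the value of the fidelity term -/

section Fidelity

variable {d : ℕ} {Ω : Set (E d)} {N : ℕ} {α β : ℝ} {c : Fin N → ℝ}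

/-- The disintegration `t ↦ ∑ j, c_j a_{γ_j} δ_{γ_j(t)}`. -/
def tupleSlice (α β : ℝ) (c : Fin N → ℝ) (Γ : Fin N → H1In Ω) (t : unitInterval) :
    SignedMeasure (closure Ω) :=
  ∑ j, (c j * weight α β (Γ j).1) • (Measure.dirac ((Γ j).pos t)).toSignedMeasure

lemma tupleSlice_apply (Γ : Fin N → H1In Ω) (t : unitInterval) {B : Set (closure Ω)}
    (hB : MeasurableSet B) : tupleSlice α β c Γ t B
      = ∑ j, (c j * weight α β (Γ j).1) * B.indicator (fun _ => 1) ((Γ j).pos t) := by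
  simp only [tupleSlice, FunLike.coe_sum, Finset.sum_apply, smul_apply, smul_eq_mul]
  refine Finset.sum_congr rfl fun j _ => ?_
  rw [Measure.toSignedMeasure_apply_measurable hB, Measure.real, Measure.dirac_apply' _ hB]
  by_cases h : (Γ j).pos t ∈ B <;> simp [h]

lemma continuous_pos (γ : H1In Ω) : Continuous γ.pos :=
  Continuous.subtype_mk γ.1.curve.continuous _

lemma tupleSlice_disintegrates (hα : 0 < α) (hβ : 0 < β) (hc : ∀ j, 0 < c j)
    (Γ : Fin N → H1In Ω) : Disintegrates (tupleMeasure α β c Γ).1 (tupleSlice α β c Γ) := by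
  refine ⟨fun B hB => ?_, fun A hA => ?_⟩
  · simp only [tupleSlice_apply Γ _ hB]
    refine Finset.measurable_sum _ fun j _ => Measurable.const_mul ?_ _
    exact (measurable_const.indicator hB).comp (continuous_pos (Γ j)).measurable
  · have hi : ∀ j, Integrable (fun t : Ioo (0 : ℝ) 1 =>
        A.indicator (fun _ => (1 : ℝ)) (t, (Γ j).pos (incl t))) dt := by
      intro j
      exact Integrable.of_bound (((measurable_const.indicator hA).comp
        (measurable_graph (Γ j))).aestronglyMeasurable) 1
        (ae_of_all _ fun t => by
          by_cases h : (t, (Γ j).pos (incl t)) ∈ A <;> simp [h])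
    have e : (fun t : Ioo (0 : ℝ) 1 => tupleSlice α β c Γ (incl t) {x | (t, x) ∈ A})
        = fun t => ∑ j, (c j * weight α β (Γ j).1) *
          A.indicator (fun _ => (1 : ℝ)) (t, (Γ j).pos (incl t)) := by
      funext t
      exact tupleSlice_apply Γ _ (measurable_prodMk_left hA)
    rw [e]
    refine ⟨integrable_finsetSum _ fun j _ => (hi j).const_mul _, ?_⟩
    rw [integral_finsetSum _ fun j _ => (hi j).const_mul _, tupleMeasure_fst hα hβ hc,
      Measure.toSignedMeasure_apply_measurable hA, Measure.real, tupleDensity]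
    simp only [Measure.coe_finsetSum, Finset.sum_apply, Measure.smul_apply, smul_eq_mul]
    rw [ENNReal.toReal_sum fun j _ => ENNReal.mul_ne_top ENNReal.ofReal_ne_top (measure_ne_top _ _)]
    refine Finset.sum_congr rfl fun j _ => ?_
    rw [integral_const_mul, ENNReal.toReal_mul,
      ENNReal.toReal_ofReal (coeff_pos hα hβ hc Γ j).le]
    congr 1
    rw [graphMeasure, Measure.map_apply (measurable_graph (Γ j)) hA]
    have e2 : (fun t : Ioo (0 : ℝ) 1 => A.indicator (fun _ => (1 : ℝ)) (t, (Γ j).pos (incl t)))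
        = ((fun t : Ioo (0 : ℝ) 1 => (t, (Γ j).pos (incl t))) ⁻¹' A).indicator fun _ => 1 := rfl
    rw [e2, integral_indicator (measurable_graph (Γ j) hA)]
    simp [Measure.real]

lemma integral_tupleSlice (Γ : Fin N → H1In Ω) (t : unitInterval)
    (φ : BoundedContinuousFunction (closure Ω) ℝ) :
    ∫ᵛ x, φ x ∂•(tupleSlice α β c Γ t)
      = ∑ j, (c j * weight α β (Γ j).1) * φ ((Γ j).pos t) := by
  rw [tupleSlice, VectorMeasure.integral_finsetSum_vectorMeasure fun j _ =>
    integrable_variation _ φ]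
  refine Finset.sum_congr rfl fun j _ => ?_
  rw [VectorMeasure.integral_smul_vectorMeasure, integral_signed, integral_dirac, smul_eq_mul]

lemma tupleSlice_narrowlyContinuous (Γ : Fin N → H1In Ω) :
    NarrowlyContinuous (tupleSlice α β c Γ) := by
  intro φ
  simp only [integral_tupleSlice]
  exact continuous_finsetSum _ fun j _ =>
    continuous_const.mul (φ.continuous.comp (continuous_pos (Γ j)))

lemma diracDual_apply (x : closure Ω) (φ : C11 Ω) : diracDual x φ = φ.fn x := by
  change ∫ᵛ y, φ.fn y ∂•(Measure.dirac x).toSignedMeasure = _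
  rw [integral_signed, integral_dirac]

lemma measToDual_tupleSlice (Γ : Fin N → H1In Ω) (t : unitInterval) :
    measToDual (tupleSlice α β c Γ t)
      = ∑ j, (c j * weight α β (Γ j).1) • diracDual ((Γ j).pos t) := by
  ext φ
  change ∫ᵛ y, φ.fn y ∂•(tupleSlice α β c Γ t) = _
  rw [integral_tupleSlice]
  simp [diracDual_apply]

/-- A disintegration with respect to `dt` is unique almost everywhere. -/
lemma Disintegrates.ae_eq {ρ : SignedMeasure (Cylinder Ω)}
    {r q : unitInterval → SignedMeasure (closure Ω)} (hr : Disintegrates ρ r)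
    (hq : Disintegrates ρ q) : r =ᵐ[volume] q := by
  have hB : ∀ B : Set (closure Ω), MeasurableSet B → ∀ᵐ t ∂dt, r (incl t) B = q (incl t) B := by
    intro B hB
    have key : ∀ {p : unitInterval → SignedMeasure (closure Ω)}, Disintegrates ρ p →
        Integrable (fun t => p (incl t) B) dt ∧ ∀ S : Set (Ioo (0 : ℝ) 1), MeasurableSet S →
          ∫ t in S, p (incl t) B ∂dt = ρ (S ×ˢ B) := by
      intro p hp
      constructor
      · have := (hp.2 (univ ×ˢ B) (MeasurableSet.univ.prod hB)).1
        simpa using this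
      · intro S hS
        rw [(hp.2 (S ×ˢ B) (hS.prod hB)).2, ← integral_indicator hS]
        refine integral_congr_ae (ae_of_all _ fun t => ?_)
        by_cases ht : t ∈ S <;> simp [ht]
    refine Integrable.ae_eq_of_forall_setIntegral_eq _ _ (key hr).1 (key hq).1 fun S hS _ => ?_
    rw [(key hr).2 S hS, (key hq).2 S hS]
  -- The exceptional null set of times depends on `B`. A countable algebra generating the Borel sets
  -- gives a common one, and being a π-system containing the whole space it determines the measures.
  let C : Set (Set (closure Ω)) :=
    generateSetAlgebra (MeasurableSpace.countableGeneratingSet (closure Ω))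
  have hCc : C.Countable :=
    countable_generateSetAlgebra (MeasurableSpace.countable_countableGeneratingSet)
  have hCg : MeasurableSpace.generateFrom C = inferInstanceAs (MeasurableSpace (closure Ω)) := by
    rw [generateFrom_generateSetAlgebra_eq, MeasurableSpace.generateFrom_countableGeneratingSet]
    rfl
  have hCm : ∀ B ∈ C, MeasurableSet B := fun B hBC => by
    have := MeasurableSpace.measurableSet_generateFrom hBC
    rwa [hCg] at this
  have halg : IsSetAlgebra C := isSetAlgebra_generateSetAlgebra
  have hall : ∀ᵐ t : unitInterval, ∀ B ∈ C, r t B = q t B := by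
    refine (ae_ball_iff hCc).2 fun B hBC => ?_
    have hm := measurableSet_eq_fun (hr.1 B (hCm B hBC)) (hq.1 B (hCm B hBC))
    rw [← measurePreserving_incl.map_eq]
    exact (ae_map_iff measurePreserving_incl.measurable.aemeasurable hm).2 (hB B (hCm B hBC))
  filter_upwards [hall] with t ht
  exact VectorMeasure.ext_of_generateFrom C ht hCg.symm (fun A hA B hB _ => halg.inter_mem hA hB)
    (ht _ halg.univ_mem)

/-- `tupleSlice` is admissible, and every other admissible family agrees with it at almost every
time, so the infimum is over a single value. -/
lemma fidelity_tupleMeasure {H : unitInterval → Type*} [∀ t, NormedAddCommGroup (H t)]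
    [∀ t, InnerProductSpace ℝ (H t)] (Ks : ∀ t, StrongDual ℝ (C11 Ω) →L[ℝ] H t) (f : ∀ t, H t)
    (hα : 0 < α) (hβ : 0 < β) (hc : ∀ j, 0 < c j) (Γ : Fin N → H1In Ω) :
    fidelity Ks f (tupleMeasure α β c Γ) = (1 / 2) * ∫⁻ t,
      ‖(∑ j, (c j * weight α β (Γ j).1) • Ks t (diracDual ((Γ j).pos t))) - f t‖ₑ ^ 2 := by
  have hr := tupleSlice_disintegrates hα hβ hc Γ
  have e : ∀ t, Ks t (measToDual (tupleSlice α β c Γ t))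
      = ∑ j, (c j * weight α β (Γ j).1) • Ks t (diracDual ((Γ j).pos t)) := by
    intro t
    rw [measToDual_tupleSlice, map_sum]
    simp only [map_smul]
  rw [fidelity]
  refine le_antisymm ?_ (le_iInf₂ fun q hq => ?_)
  · refine (iInf₂_le _ ⟨hr, tupleSlice_narrowlyContinuous Γ⟩).trans_eq ?_
    simp only [e]
  · refine le_of_eq ?_
    congr 1
    refine lintegral_congr_ae ?_
    filter_upwards [hr.ae_eq hq.1] with t ht
    rw [← e, ht]

end Fidelity

/-! ### Measurability of fields in varying Hilbert spaces -/

section Measurability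

lemma aemeasurable_simpleFunc_section {A B : Type*} [MeasurableSpace A] {μ : Measure A}
    (s : SimpleFunc A B) {F : B → A → ℝ} (hF : ∀ b, AEMeasurable (F b) μ) :
    AEMeasurable (fun t => F (s t) t) μ := by
  classical
  have e : (fun t => F (s t) t) = fun t => ∑ b ∈ s.range, (s ⁻¹' {b}).indicator (F b) t := by
    funext t
    rw [Finset.sum_eq_single (s t)]
    · simp
    · intro b _ hb
      exact indicator_of_notMem (fun h => hb h.symm) _
    · intro h
      exact absurd (s.mem_range_self t) h
  rw [e]
  exact Finset.aemeasurable_fun_sum _ fun b _ => (hF b).indicator (s.measurableSet_fiber b)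

variable {H : unitInterval → Type*} [∀ t, NormedAddCommGroup (H t)] [∀ t, InnerProductSpace ℝ (H t)]
  {D : Type*} [NormedAddCommGroup D] [NormedSpace ℝ D]

/-- Fields with measurable inner product against every strongly measurable field. -/
def WeaklyMeas (i : ∀ t, D →L[ℝ] H t) (g : ∀ t, H t) : Prop :=
  ∀ h, StronglyMeas i h → AEMeasurable fun t => ⟪g t, h t⟫

/-- Fields with measurable inner product against every weakly measurable field. This class contains
the strongly measurable fields and is stable under weak limits. -/
def BiMeas (i : ∀ t, D →L[ℝ] H t) (g : ∀ t, H t) : Prop :=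
  ∀ h, WeaklyMeas i h → AEMeasurable fun t => ⟪g t, h t⟫

variable {i : ∀ t, D →L[ℝ] H t}

/-- For approximating simple fields the inner product is, piece by piece, one of the functions `⟪i t
φ, i t ψ⟫` assumed measurable; norm limits preserve this. -/
lemma StronglyMeas.weaklyMeas (hH : SamplingAssumptions i) {g : ∀ t, H t}
    (hg : StronglyMeas i g) : WeaklyMeas i g := by
  rintro h ⟨s', hs'⟩
  obtain ⟨s, hs⟩ := hg
  refine aemeasurable_of_tendsto_metrizable_ae atTop
    (f := fun n t => ⟪i t (s n t), i t (s' n t)⟫) (fun n => ?_) ?_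
  · exact aemeasurable_simpleFunc_section (s n) (F := fun φ t => ⟪i t φ, i t (s' n t)⟫) fun φ =>
      aemeasurable_simpleFunc_section (s' n) (F := fun ψ t => ⟪i t φ, i t ψ⟫) fun ψ =>
        hH.measurable φ ψ
  · filter_upwards [hs, hs'] with t ht ht'
    exact ht.inner ht'

lemma StronglyMeas.biMeas {g : ∀ t, H t} (hg : StronglyMeas i g) : BiMeas i g := by
  intro h hh
  refine (hh g hg).congr (ae_of_all _ fun t => ?_)
  exact real_inner_comm _ _

lemma BiMeas.weaklyMeas (hH : SamplingAssumptions i) {g : ∀ t, H t} (hg : BiMeas i g) :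
    WeaklyMeas i g := fun h hh => hg h (hh.weaklyMeas hH)

lemma BiMeas.inner (hH : SamplingAssumptions i) {g h : ∀ t, H t} (hg : BiMeas i g)
    (hh : BiMeas i h) : AEMeasurable fun t => ⟪g t, h t⟫ := hg h (hh.weaklyMeas hH)

lemma BiMeas.norm (hH : SamplingAssumptions i) {g : ∀ t, H t} (hg : BiMeas i g) :
    AEMeasurable fun t => ‖g t‖ := by
  refine ((hg.inner hH hg).sqrt).congr (ae_of_all _ fun t => ?_)
  simp only [real_inner_self_eq_norm_sq]
  exact Real.sqrt_sq (norm_nonneg _)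

/-- Only weak convergence is asked for, which is all that weak*-to-weak continuity of the forward
operators supplies. -/
lemma BiMeas.of_tendsto {g : ∀ t, H t} {s : ℕ → ∀ t, H t} (hs : ∀ n, BiMeas i (s n))
    (hl : ∀ᵐ t, ∀ h : H t, Tendsto (fun n => ⟪s n t, h⟫) atTop (𝓝 ⟪g t, h⟫)) : BiMeas i g := by
  intro h hh
  exact aemeasurable_of_tendsto_metrizable_ae atTop (fun n => hs n h hh)
    (hl.mono fun t ht => ht (h t))

lemma BiMeas.sub {g h : ∀ t, H t} (hg : BiMeas i g) (hh : BiMeas i h) :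
    BiMeas i fun t => g t - h t := by
  intro k hk
  simp only [inner_sub_left]
  exact (hg k hk).sub (hh k hk)

lemma BiMeas.const_smul {g : ∀ t, H t} (hg : BiMeas i g) (a : ℝ) : BiMeas i fun t => a • g t := by
  intro k hk
  simp only [real_inner_smul_left]
  exact (hg k hk).const_mul a

lemma BiMeas.sum {ι : Type*} (s : Finset ι) {g : ι → ∀ t, H t} (hg : ∀ j ∈ s, BiMeas i (g j)) :
    BiMeas i fun t => ∑ j ∈ s, g j t := by
  intro k hk
  simp only [sum_inner]
  exact Finset.aemeasurable_fun_sum _ fun j hj => hg j hj k hk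

end Measurability

/-! ### Differentiability of Dirac masses in the dual of `C11` -/

section Dirac

variable {d : ℕ} {Ω : Set (E d)}

lemma C11.extZero_coe (φ : C11 Ω) (x : closure Ω) : φ.extZero x = φ.fn x :=
  Subtype.val_injective.extend_apply _ _ x

lemma C11.extZero_of_notMem (φ : C11 Ω) {x : E d} (hx : x ∉ closure Ω) : φ.extZero x = 0 :=
  Function.extend_apply' _ _ _ (by simpa using hx)

lemma C11.norm_grad_le (φ : C11 Ω) (x : closure Ω) : ‖φ.grad x‖ ≤ ‖φ‖ := by
  have := φ.grad.norm_coe_le_norm x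
  rw [C11.norm_def]
  linarith [norm_nonneg φ.fn, lipSup_nonneg φ.grad]

lemma C11.norm_grad_sub_le (φ : C11 Ω) (x y : closure Ω) :
    ‖φ.grad x - φ.grad y‖ ≤ ‖φ‖ * ‖(x : E d) - y‖ := by
  by_cases h : (x : E d) = y
  · rw [Subtype.ext h]
    simp
  · have h1 : 0 < ‖(x : E d) - y‖ := norm_pos_iff.2 (sub_ne_zero.2 h)
    have h2 := le_ciSup (lipSup_bdd φ) (x, y)
    simp only at h2
    rw [div_le_iff₀ h1] at h2
    refine h2.trans (mul_le_mul_of_nonneg_right ?_ h1.le)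
    rw [C11.norm_def]
    change lipSup φ.grad ≤ _
    linarith [norm_nonneg φ.fn, norm_nonneg φ.grad]

/-- The gradient at `x`, as an operator from `ℝ^d` to the dual of `C^{1,1}`. -/
def gradDual (x : closure Ω) : E d →L[ℝ] StrongDual ℝ (C11 Ω) :=
  LinearMap.mkContinuous₂
    (LinearMap.mk₂ ℝ (fun (v : E d) (φ : C11 Ω) => ⟪φ.grad x, v⟫)
      (fun _ _ _ => inner_add_right _ _ _) (fun _ _ _ => real_inner_smul_right _ _ _)
      (fun _ _ _ => inner_add_left _ _ _) (fun _ _ _ => real_inner_smul_left _ _ _)) 1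
    (fun v φ => by
      rw [one_mul, mul_comm]
      exact (norm_inner_le_norm _ _).trans
        (mul_le_mul_of_nonneg_right (φ.norm_grad_le x) (norm_nonneg _)))

lemma gradDual_apply (x : closure Ω) (v : E d) (φ : C11 Ω) : gradDual x v φ = ⟪φ.grad x, v⟫ := rfl

lemma norm_gradDual_le (x : closure Ω) : ‖gradDual x‖ ≤ 1 :=
  LinearMap.mkContinuous₂_norm_le _ zero_le_one _

lemma norm_gradDual_sub_le (x y : closure Ω) : ‖gradDual x - gradDual y‖ ≤ ‖(x : E d) - y‖ := by
  refine ContinuousLinearMap.opNorm_le_bound₂ _ (norm_nonneg _) fun v φ => ?_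
  simp only [sub_apply, gradDual_apply]
  rw [← inner_sub_left]
  refine (norm_inner_le_norm _ _).trans ?_
  refine (mul_le_mul_of_nonneg_right (φ.norm_grad_sub_le x y) (norm_nonneg v)).trans_eq ?_
  ring

lemma norm_diracDual_le (x : closure Ω) : ‖diracDual x‖ ≤ 1 := by
  refine ContinuousLinearMap.opNorm_le_bound _ zero_le_one fun φ => ?_
  rw [diracDual_apply, one_mul]
  exact (φ.fn.norm_coe_le_norm x).trans φ.norm_fn_le

open Classical in
variable (Ω) in
/-- The Dirac mass at `x`, extended by zero outside the closure of `Ω`. -/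
def diracExt (x : E d) : StrongDual ℝ (C11 Ω) :=
  if h : x ∈ closure Ω then diracDual ⟨x, h⟩ else 0

open Classical in
variable (Ω) in
/-- The gradient at `x`, extended by zero outside the closure of `Ω`. -/
def gradExt (x : E d) : E d →L[ℝ] StrongDual ℝ (C11 Ω) :=
  if h : x ∈ closure Ω then gradDual ⟨x, h⟩ else 0

lemma diracExt_coe (x : closure Ω) : diracExt Ω x = diracDual x := dif_pos x.2

lemma gradExt_coe (x : closure Ω) : gradExt Ω x = gradDual x := dif_pos x.2

lemma diracExt_apply (x : E d) (φ : C11 Ω) : diracExt Ω x φ = φ.extZero x := by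
  by_cases h : x ∈ closure Ω
  · lift x to closure Ω using h
    rw [diracExt_coe, diracDual_apply, φ.extZero_coe]
  · rw [diracExt, dif_neg h, φ.extZero_of_notMem h]
    rfl

lemma norm_diracExt_le (x : E d) : ‖diracExt Ω x‖ ≤ 1 := by
  by_cases h : x ∈ closure Ω
  · lift x to closure Ω using h
    rw [diracExt_coe]
    exact norm_diracDual_le x
  · rw [diracExt, dif_neg h, norm_zero]
    exact zero_le_one

lemma norm_gradExt_le (x : E d) : ‖gradExt Ω x‖ ≤ 1 := by
  by_cases h : x ∈ closure Ω
  · lift x to closure Ω using h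
    rw [gradExt_coe]
    exact norm_gradDual_le x
  · rw [gradExt, dif_neg h]
    exact (norm_zero (E := E d →L[ℝ] StrongDual ℝ (C11 Ω))).trans_le zero_le_one

lemma norm_gradExt_sub_le {x y : E d} (hx : x ∈ closure Ω) (hy : y ∈ closure Ω) :
    ‖gradExt Ω x - gradExt Ω y‖ ≤ ‖x - y‖ := by
  lift x to closure Ω using hx
  lift y to closure Ω using hy
  rw [gradExt_coe, gradExt_coe]
  exact norm_gradDual_sub_le x y

lemma continuousOn_gradExt : ContinuousOn (gradExt Ω) (closure Ω) := by
  intro x hx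
  refine (tendsto_iff_norm_sub_tendsto_zero (E := E d →L[ℝ] StrongDual ℝ (C11 Ω))).2 ?_
  have h : Tendsto (fun y => ‖y - x‖) (𝓝[closure Ω] x) (𝓝 0) :=
    (tendsto_iff_norm_sub_tendsto_zero.1 tendsto_id).mono_left nhdsWithin_le_nhds
  refine squeeze_zero' (Eventually.of_forall fun y => norm_nonneg (gradExt Ω y - gradExt Ω x)) ?_ h
  filter_upwards [self_mem_nhdsWithin] with y hy
  exact norm_gradExt_sub_le hy hx

lemma C11.hasFDerivAt_extZero (φ : C11 Ω) {x : E d} (hx : x ∈ Ω) :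
    HasFDerivAt φ.extZero ((gradExt Ω x).flip φ) x := by
  have h := (φ.2.1 x hx).hasFDerivAt
  have e : (gradExt Ω x).flip φ = InnerProductSpace.toDual ℝ (E d)
      (φ.1.2 ⟨x, subset_closure hx⟩) := by
    ext v
    rw [ContinuousLinearMap.flip_apply, gradExt, dif_pos (subset_closure hx)]
    rfl
  rw [e]
  exact h

/-- On the ball, which is convex and inside `Ω`, the gradient of `φ` varies by at most `‖φ‖ ‖y -
x‖`, so the mean value inequality bounds the Taylor remainder. The bound is uniform over `φ` of norm
one, hence holds in the dual norm; the Lipschitz part of the norm of `C11` is needed here. -/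
lemma norm_diracExt_sub_le {x y : E d} (h : Metric.closedBall x ‖y - x‖ ⊆ Ω) :
    ‖diracExt Ω y - diracExt Ω x - gradExt Ω x (y - x)‖ ≤ ‖y - x‖ * ‖y - x‖ := by
  have hx : x ∈ Ω := h (Metric.mem_closedBall_self (norm_nonneg _))
  refine ContinuousLinearMap.opNorm_le_bound _ (by positivity) fun φ => ?_
  have key := (convex_closedBall x ‖y - x‖).norm_image_sub_le_of_norm_hasFDerivWithin_le'
    (f := φ.extZero) (f' := fun z => (gradExt Ω z).flip φ) (φ := (gradExt Ω x).flip φ)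
    (C := ‖y - x‖ * ‖φ‖) (x := x) (y := y)
    (fun z hz => (φ.hasFDerivAt_extZero (h hz)).hasFDerivWithinAt)
    (fun z hz => by
      change ‖(gradExt Ω z - gradExt Ω x).flip φ‖ ≤ _
      refine (ContinuousLinearMap.le_opNorm _ _).trans ?_
      refine mul_le_mul_of_nonneg_right ?_ (norm_nonneg _)
      rw [ContinuousLinearMap.opNorm_flip]
      refine (norm_gradExt_sub_le (subset_closure (h hz)) (subset_closure hx)).trans ?_
      rw [← dist_eq_norm]
      exact hz)
    (Metric.mem_closedBall_self (norm_nonneg _)) (by simp [dist_eq_norm])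
  simp only [sub_apply, diracExt_apply]
  refine key.trans_eq ?_
  ring

/-- The map `x ↦ δ_x` is differentiable in `Ω`, with values in the dual of `C^{1,1}`. -/
lemma hasFDerivAt_diracExt (hΩ : IsOpen Ω) {x : E d} (hx : x ∈ Ω) :
    HasFDerivAt (diracExt Ω) (gradExt Ω x) x := by
  rw [hasFDerivAt_iff_isLittleO, Asymptotics.isLittleO_iff]
  intro ε hε
  obtain ⟨r, hr, hrΩ⟩ := Metric.isOpen_iff.1 hΩ x hx
  -- The radius `r` keeps the ball inside `Ω`, and `ε` turns the quadratic remainder into a small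
  -- multiple of `‖y - x‖`.
  filter_upwards [Metric.ball_mem_nhds x (lt_min hε hr)] with y hy
  rw [Metric.mem_ball, dist_eq_norm, lt_min_iff] at hy
  refine (norm_diracExt_sub_le ((Metric.closedBall_subset_ball hy.2).trans hrΩ)).trans ?_
  exact mul_le_mul_of_nonneg_right hy.1.le (norm_nonneg _)

end Dirac

/-! ### Measurability of forward images of Diracs and gradients -/

section ForwardFields

variable {d : ℕ} {Ω : Set (E d)}
  {H : unitInterval → Type*} [∀ t, NormedAddCommGroup (H t)] [∀ t, InnerProductSpace ℝ (H t)]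
  {D : Type*} [NormedAddCommGroup D] [NormedSpace ℝ D]
  {i : ∀ t, D →L[ℝ] H t} {Ks : ∀ t, StrongDual ℝ (C11 Ω) →L[ℝ] H t}

/-- For a fixed point this is assumed, so it holds for simple paths. Tested against `h`, the field
is the continuous function `preadjoint (Ks t) h` at the moving point, so the approximations converge
weakly. -/
lemma biMeas_diracDual (hK : ForwardAssumptions i Ks) {x : unitInterval → closure Ω}
    (hx : Measurable x) : BiMeas i fun t => Ks t (diracDual (x t)) := by
  have hs := hx.stronglyMeasurable
  refine BiMeas.of_tendsto (s := fun n t => Ks t (diracDual (hs.approx n t))) (fun n h hh => ?_) ?_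
  · exact aemeasurable_simpleFunc_section (hs.approx n) (F := fun y t => ⟪Ks t (diracDual y), h t⟫)
      fun y => (hK.measurable _).biMeas h hh
  · filter_upwards [hK.weak_continuous] with t ht h
    simp only [inner_eq_preadjoint ht, diracDual_apply]
    exact ((preadjoint (Ks t) h).fn.continuous.tendsto _).comp (hs.tendsto_approx t)

lemma biMeas_diracExt (hK : ForwardAssumptions i Ks) {x : unitInterval → E d}
    (hx : Measurable x) : BiMeas i fun t => Ks t (diracExt Ω (x t)) := by
  classical
  by_cases hne : Nonempty (closure Ω)
  · obtain ⟨p⟩ := hne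
    intro h hh
    have hA : MeasurableSet {t | x t ∈ closure Ω} := hx isClosed_closure.measurableSet
    let y : unitInterval → closure Ω := fun t => if ht : x t ∈ closure Ω then ⟨x t, ht⟩ else p
    have hy : Measurable y := by
      refine (MeasurableEmbedding.subtype_coe isClosed_closure.measurableSet).measurable_comp_iff.1 ?_
      have e : Subtype.val ∘ y = fun t => if x t ∈ closure Ω then x t else (p : E d) := by
        funext t
        by_cases ht : x t ∈ closure Ω <;> simp [y, ht]
      rw [e]
      exact Measurable.ite hA hx measurable_const
    refine ((biMeas_diracDual hK hy h hh).indicator hA).congr (ae_of_all _ fun t => ?_)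
    by_cases ht : x t ∈ closure Ω
    · simp [y, ht, diracExt]
    · simp [ht, diracExt]
  · intro h _
    refine aemeasurable_const (b := (0 : ℝ)) |>.congr (ae_of_all _ fun t => ?_)
    have ht : x t ∉ closure Ω := fun ht => hne ⟨⟨x t, ht⟩⟩
    simp [diracExt, ht]

/-- A directional derivative is a limit of difference quotients of Dirac fields. The shifted points
may leave the closure of `Ω` for small `n`, hence the extension by zero. -/
lemma biMeas_gradExt (hΩ : IsOpen Ω) (hK : ForwardAssumptions i Ks) {x : unitInterval → E d}
    (hx : Measurable x) (hxΩ : ∀ t, x t ∈ Ω) (v : E d) :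
    BiMeas i fun t => Ks t (gradExt Ω (x t) v) := by
  refine BiMeas.of_tendsto (s := fun n t => ((n : ℝ) + 1) •
    (Ks t (diracExt Ω (x t + ((n : ℝ) + 1)⁻¹ • v)) - Ks t (diracExt Ω (x t)))) (fun n => ?_) ?_
  · exact ((biMeas_diracExt hK (hx.add_const _)).sub (biMeas_diracExt hK hx)).const_smul _
  · refine ae_of_all _ fun t h => ?_
    have hc : Tendsto (fun n : ℕ => ‖(n : ℝ) + 1‖) atTop atTop :=
      tendsto_norm_atTop_atTop.comp (tendsto_atTop_add_const_right _ _ tendsto_natCast_atTop_atTop)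
    have hl := (hasFDerivAt_diracExt hΩ (hxΩ t)).lim v hc
    have hl2 := ((Ks t).continuous.tendsto _).comp hl
    simp only [Function.comp_def, map_smul, map_sub] at hl2
    exact hl2.inner tendsto_const_nhds

end ForwardFields

/-! ### The field of a single curve and its derivative -/

section CurveFields

variable {d : ℕ} {Ω : Set (E d)}
  {H : unitInterval → Type*} [∀ t, NormedAddCommGroup (H t)] [∀ t, InnerProductSpace ℝ (H t)]
  {D : Type*} [NormedAddCommGroup D] [NormedSpace ℝ D]
  {i : ∀ t, D →L[ℝ] H t} {Ks : ∀ t, StrongDual ℝ (C11 Ω) →L[ℝ] H t} {α β : ℝ}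

/-- The field `t ↦ a_γ K_t^* δ_{γ(t)}`. -/
def curveField (Ks : ∀ t, StrongDual ℝ (C11 Ω) →L[ℝ] H t) (α β : ℝ) (γ : H1 d)
    (t : unitInterval) : H t := weight α β γ • Ks t (diracExt Ω (γ t))

/-- The derivative of `γ ↦ a_γ K_t^* δ_{γ(t)}`. -/
def curveFieldDeriv (Ks : ∀ t, StrongDual ℝ (C11 Ω) →L[ℝ] H t) (α β : ℝ) (γ : H1 d)
    (t : unitInterval) : H1 d →L[ℝ] H t :=
  weight α β γ • (Ks t).comp ((gradExt Ω (γ t)).comp (evalCLM t))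
    + (fderiv ℝ (weight α β) γ).smulRight (Ks t (diracExt Ω (γ t)))

lemma hasFDerivAt_curveField (hΩ : IsOpen Ω) (hα : 0 < α) (hβ : 0 < β) {γ : H1 d}
    {t : unitInterval} (hγ : γ t ∈ Ω) :
    HasFDerivAt (fun η => curveField Ks α β η t) (curveFieldDeriv Ks α β γ t) γ := by
  have h1 : HasFDerivAt (weight α β) (fderiv ℝ (weight α β) γ) γ :=
    ((contDiff_weight hα hβ).differentiable (by simp) γ).hasFDerivAt
  have h2 : HasFDerivAt (fun η : H1 d => diracExt Ω (η t)) ((gradExt Ω (γ t)).comp (evalCLM t)) γ :=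
    HasFDerivAt.comp (g := diracExt Ω) (f := fun η : H1 d => η t) γ
      (hasFDerivAt_diracExt hΩ hγ) (evalCLM t).hasFDerivAt
  exact h1.smul ((Ks t).hasFDerivAt.comp γ h2)

lemma norm_curveField_le (hα : 0 < α) (hβ : 0 < β) (γ : H1 d) {t : unitInterval} {C : ℝ}
    (hC : ‖Ks t‖ ≤ C) : ‖curveField Ks α β γ t‖ ≤ α⁻¹ * C := by
  rw [curveField, norm_smul, Real.norm_of_nonneg (weight_pos hα hβ γ).le]
  refine mul_le_mul (weight_le hα hβ γ) ?_ (norm_nonneg _) (inv_pos.2 hα).le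
  refine ((Ks t).le_opNorm _).trans ((mul_le_of_le_one_right (norm_nonneg _)
    (norm_diracExt_le _)).trans hC)

lemma norm_curveFieldDeriv_le (hα : 0 < α) (hβ : 0 < β) (γ : H1 d) {t : unitInterval} {C : ℝ}
    (hC : ‖Ks t‖ ≤ C) :
    ‖curveFieldDeriv Ks α β γ t‖ ≤ α⁻¹ * (C * 2) + ‖fderiv ℝ (weight α β) γ‖ * C := by
  have hC0 : 0 ≤ C := (norm_nonneg (Ks t)).trans hC
  refine (norm_add_le _ _).trans (add_le_add ?_ ?_)
  · rw [norm_smul, Real.norm_of_nonneg (weight_pos hα hβ γ).le]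
    refine mul_le_mul (weight_le hα hβ γ) ?_ (norm_nonneg _) (inv_pos.2 hα).le
    refine (ContinuousLinearMap.opNorm_comp_le _ _).trans ?_
    refine mul_le_mul hC ?_ (norm_nonneg _) hC0
    refine (ContinuousLinearMap.opNorm_comp_le _ _).trans ?_
    exact (mul_le_of_le_one_left (norm_nonneg _) (norm_gradExt_le _)).trans (norm_evalCLM_le t)
  · rw [ContinuousLinearMap.norm_smulRight_apply]
    refine mul_le_mul_of_nonneg_left ?_ (norm_nonneg _)
    exact ((Ks t).le_opNorm _).trans ((mul_le_of_le_one_right (norm_nonneg _)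
      (norm_diracExt_le _)).trans hC)

lemma continuousOn_curveFieldDeriv (hΩ : IsOpen Ω) (hα : 0 < α) (hβ : 0 < β) (t : unitInterval) :
    ContinuousOn (fun γ => curveFieldDeriv Ks α β γ t) {γ : H1 d | γ t ∈ Ω} := by
  have hw := contDiff_weight (d := d) hα hβ
  have he : ContinuousOn (fun γ : H1 d => γ t) {γ : H1 d | γ t ∈ Ω} :=
    (evalCLM t).continuous.continuousOn
  have hδ : ContinuousOn (diracExt Ω) Ω := fun x hx =>
    (hasFDerivAt_diracExt hΩ hx).continuousAt.continuousWithinAt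
  refine ContinuousOn.add (hw.continuous.continuousOn.smul ?_) ?_
  · refine continuousOn_const.clm_comp (ContinuousOn.clm_comp ?_ continuousOn_const)
    exact (continuousOn_gradExt.mono subset_closure).comp he fun γ hγ => hγ
  · have h1 : ContinuousOn (fun γ : H1 d => Ks t (diracExt Ω (γ t))) {γ : H1 d | γ t ∈ Ω} :=
      (Ks t).continuous.comp_continuousOn (hδ.comp he fun γ hγ => hγ)
    have h2 : ContinuousOn (fun γ : H1 d => fderiv ℝ (weight α β) γ) {γ : H1 d | γ t ∈ Ω} :=
      (hw.continuous_fderiv (by simp)).continuousOn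
    exact ((ContinuousLinearMap.smulRightL ℝ (H1 d) (H t)).continuous.comp_continuousOn h2).clm_apply h1

lemma biMeas_curveField (hK : ForwardAssumptions i Ks) (γ : H1 d) :
    BiMeas i (curveField Ks α β γ) :=
  (biMeas_diracExt hK γ.curve.continuous.measurable).const_smul _

/-- Expanding `η t` in the standard basis writes the operator as a finite sum of measurable scalar
functions times operators that are norm continuous in `t` or constant. -/
lemma aestronglyMeasurable_inner_curveFieldDeriv (hH : SamplingAssumptions i)
    (hK : ForwardAssumptions i Ks) (hΩ : IsOpen Ω) {g : ∀ t, H t} (hg : BiMeas i g) {γ : H1 d}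
    (hγ : ∀ t, γ t ∈ Ω) :
    AEStronglyMeasurable (fun t => (innerSL ℝ (g t)).comp (curveFieldDeriv Ks α β γ t)) volume := by
  let b := EuclideanSpace.basisFun (Fin d) ℝ
  have e : (fun t => (innerSL ℝ (g t)).comp (curveFieldDeriv Ks α β γ t)) = fun t =>
      weight α β γ • (∑ k, ⟪g t, Ks t (gradExt Ω (γ t) (b k))⟫ •
        (EuclideanSpace.proj (𝕜 := ℝ) k : E d →L[ℝ] ℝ).comp (evalCLM t)) +
      ⟪g t, Ks t (diracExt Ω (γ t))⟫ • fderiv ℝ (weight α β) γ := by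
    funext t
    ext η
    have hη : η t = ∑ k, η t k • b k := by
      refine (b.sum_repr (η t)).symm.trans (Finset.sum_congr rfl fun k _ => ?_)
      rw [EuclideanSpace.basisFun_repr]
    simp only [curveFieldDeriv, ContinuousLinearMap.comp_apply, add_apply, smul_apply,
      innerSL_apply_apply, ContinuousLinearMap.smulRight_apply, sum_apply, evalCLM_apply,
      PiLp.proj_apply, inner_add_right, real_inner_smul_right, smul_eq_mul]
    congr 1
    · congr 1
      conv_lhs => rw [hη]
      simp only [map_sum, map_smul, inner_sum, real_inner_smul_right]
      exact Finset.sum_congr rfl fun k _ => mul_comm _ _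
    · exact mul_comm _ _
  rw [e]
  have hm : Measurable fun t => γ t := γ.curve.continuous.measurable
  refine AEStronglyMeasurable.add (AEStronglyMeasurable.fun_const_smul ?_ _) ?_
  · refine Finset.aestronglyMeasurable_fun_sum _ fun k _ => AEStronglyMeasurable.fun_smul ?_ ?_
    · exact (hg.inner hH (biMeas_gradExt hΩ hK hm hγ (b k))).aestronglyMeasurable
    · exact (continuous_const.clm_comp continuous_evalCLM).aestronglyMeasurable
  · exact ((hg.inner hH (biMeas_diracExt hK hm)).aestronglyMeasurable).smul_const _

lemma ForwardAssumptions.exists_bound (hK : ForwardAssumptions i Ks) :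
    ∃ C : ℝ, 0 ≤ C ∧ ∀ᵐ t, ‖Ks t‖ ≤ C := by
  obtain ⟨C, hC⟩ := hK.bounded
  exact ⟨max C 0, le_max_right _ _, hC.mono fun t ht => ht.trans (le_max_left _ _)⟩

lemma exists_nhds_fderiv_weight_le (hα : 0 < α) (hβ : 0 < β) (γ : H1 d) :
    ∃ M : ℝ, IsOpen {η : H1 d | ‖fderiv ℝ (weight α β) η‖ < M} ∧
      ‖fderiv ℝ (weight α β) γ‖ < M :=
  ⟨‖fderiv ℝ (weight α β) γ‖ + 1, isOpen_lt
    ((contDiff_weight hα hβ).continuous_fderiv (by simp)).norm continuous_const, lt_add_one _⟩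

lemma integrable_inner_curveFieldDeriv (hH : SamplingAssumptions i)
    (hK : ForwardAssumptions i Ks) (hΩ : IsOpen Ω) (hα : 0 < α) (hβ : 0 < β)
    {g : ∀ t, H t} (hg : BiMeas i g) (hgi : Integrable fun t => ‖g t‖) {γ : H1 d}
    (hγ : ∀ t, γ t ∈ Ω) :
    Integrable fun t => (innerSL ℝ (g t)).comp (curveFieldDeriv Ks α β γ t) := by
  obtain ⟨C, -, hC⟩ := hK.exists_bound
  refine Integrable.mono' (hgi.mul_const (α⁻¹ * (C * 2) + ‖fderiv ℝ (weight α β) γ‖ * C))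
    (aestronglyMeasurable_inner_curveFieldDeriv hH hK hΩ hg hγ) ?_
  filter_upwards [hC] with t ht
  refine (ContinuousLinearMap.opNorm_comp_le _ _).trans ?_
  rw [innerSL_apply_norm]
  exact mul_le_mul_of_nonneg_left (norm_curveFieldDeriv_le hα hβ γ ht) (norm_nonneg _)

/-- The derivative of `γ ↦ ∫ ⟪g_t, a_γ K_t^* δ_{γ(t)}⟫ dt` at a curve in `Ω`. -/
lemma hasFDerivAt_integral_inner_curveField (hH : SamplingAssumptions i)
    (hK : ForwardAssumptions i Ks) (hΩ : IsOpen Ω) (hα : 0 < α) (hβ : 0 < β)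
    {g : ∀ t, H t} (hg : BiMeas i g) (hgi : Integrable fun t => ‖g t‖) {γ : H1 d}
    (hγ : ∀ t, γ t ∈ Ω) :
    HasFDerivAt (fun η : H1 d => ∫ t, ⟪g t, curveField Ks α β η t⟫)
      (∫ t, (innerSL ℝ (g t)).comp (curveFieldDeriv Ks α β γ t)) γ := by
  obtain ⟨C, hC0, hC⟩ := hK.exists_bound
  obtain ⟨M, hMo, hM⟩ := exists_nhds_fderiv_weight_le hα hβ γ
  -- Nearby curves stay in `Ω` for differentiability, and have bounded weight derivative for a
  -- domination independent of the curve.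
  have hs := (isOpen_forall_mem hΩ).inter hMo
  refine hasFDerivAt_integral_of_dominated_of_fderiv_le
    (bound := fun t => ‖g t‖ * (α⁻¹ * (C * 2) + M * C))
    (F' := fun η t => (innerSL ℝ (g t)).comp (curveFieldDeriv Ks α β η t))
    (hs.mem_nhds ⟨hγ, hM⟩) ?_ ?_ ?_ ?_ (hgi.mul_const _) ?_
  · exact Eventually.of_forall fun η =>
      (hg.inner hH (biMeas_curveField hK η)).aestronglyMeasurable
  · refine Integrable.mono' (hgi.mul_const (α⁻¹ * C))
      (hg.inner hH (biMeas_curveField hK γ)).aestronglyMeasurable ?_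
    filter_upwards [hC] with t ht
    exact (norm_inner_le_norm _ _).trans
      (mul_le_mul_of_nonneg_left (norm_curveField_le hα hβ γ ht) (norm_nonneg _))
  · exact aestronglyMeasurable_inner_curveFieldDeriv hH hK hΩ hg hγ
  · filter_upwards [hC] with t ht η hη
    refine (ContinuousLinearMap.opNorm_comp_le _ _).trans ?_
    rw [innerSL_apply_norm]
    refine mul_le_mul_of_nonneg_left ((norm_curveFieldDeriv_le hα hβ η ht).trans ?_) (norm_nonneg _)
    gcongr
    exact hη.2.le
  · refine ae_of_all _ fun t η hη => ?_
    exact (innerSL ℝ (g t)).hasFDerivAt.comp η (hasFDerivAt_curveField hΩ hα hβ (hη.1 t))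

end CurveFields

/-! ### The residual and differentiation of the fidelity term -/

section TupleFields

variable {d : ℕ} {Ω : Set (E d)} {N : ℕ}
  {H : unitInterval → Type*} [∀ t, NormedAddCommGroup (H t)] [∀ t, InnerProductSpace ℝ (H t)]
  {D : Type*} [NormedAddCommGroup D] [NormedSpace ℝ D]
  {i : ∀ t, D →L[ℝ] H t} {Ks : ∀ t, StrongDual ℝ (C11 Ω) →L[ℝ] H t} {α β : ℝ}
  {f : ∀ t, H t} {c : Fin N → ℝ}

/-- The residual `∑ j, c_j a_{γ_j} K_t^* δ_{γ_j(t)} - f_t`. -/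
def residual (Ks : ∀ t, StrongDual ℝ (C11 Ω) →L[ℝ] H t) (f : ∀ t, H t) (α β : ℝ)
    (c : Fin N → ℝ) (Γ : Fin N → H1 d) (t : unitInterval) : H t :=
  (∑ j, c j • curveField Ks α β (Γ j) t) - f t

/-- The derivative of the residual. -/
def residualDeriv (Ks : ∀ t, StrongDual ℝ (C11 Ω) →L[ℝ] H t) (α β : ℝ)
    (c : Fin N → ℝ) (Γ : Fin N → H1 d) (t : unitInterval) : (Fin N → H1 d) →L[ℝ] H t :=
  ∑ j, c j • (curveFieldDeriv Ks α β (Γ j) t).comp (ContinuousLinearMap.proj j)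

lemma hasFDerivAt_residual (hΩ : IsOpen Ω) (hα : 0 < α) (hβ : 0 < β) {Γ : Fin N → H1 d}
    {t : unitInterval} (hΓ : ∀ j, Γ j t ∈ Ω) :
    HasFDerivAt (fun Λ => residual Ks f α β c Λ t) (residualDeriv Ks α β c Γ t) Γ := by
  refine HasFDerivAt.sub_const (f t) (HasFDerivAt.fun_sum fun j _ => HasFDerivAt.fun_const_smul ?_ (c j))
  exact HasFDerivAt.comp (g := fun η => curveField Ks α β η t) (f := fun Λ : Fin N → H1 d => Λ j) Γ
    (hasFDerivAt_curveField hΩ hα hβ (hΓ j)) (ContinuousLinearMap.proj (R := ℝ) (φ := fun _ : Fin N => H1 d) j).hasFDerivAt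

lemma norm_residual_le (hα : 0 < α) (hβ : 0 < β) (hc : ∀ j, 0 < c j) (Γ : Fin N → H1 d)
    {t : unitInterval} {C : ℝ} (hC : ‖Ks t‖ ≤ C) :
    ‖residual Ks f α β c Γ t‖ ≤ (∑ j, c j) * (α⁻¹ * C) + ‖f t‖ := by
  refine (norm_sub_le _ _).trans (add_le_add_left ?_ _)
  rw [Finset.sum_mul]
  refine (norm_sum_le _ _).trans (Finset.sum_le_sum fun j _ => ?_)
  rw [norm_smul, Real.norm_of_nonneg (hc j).le]
  exact mul_le_mul_of_nonneg_left (norm_curveField_le hα hβ _ hC) (hc j).le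

lemma norm_residualDeriv_le (hα : 0 < α) (hβ : 0 < β) (hc : ∀ j, 0 < c j) {Γ : Fin N → H1 d}
    {t : unitInterval} {C M : ℝ} (hC : ‖Ks t‖ ≤ C)
    (hM : ∀ j, ‖fderiv ℝ (weight α β) (Γ j)‖ ≤ M) :
    ‖residualDeriv Ks α β c Γ t‖ ≤ (∑ j, c j) * (α⁻¹ * (C * 2) + M * C) := by
  have hC0 : 0 ≤ C := (norm_nonneg (Ks t)).trans hC
  rw [residualDeriv, Finset.sum_mul]
  refine (norm_sum_le _ _).trans (Finset.sum_le_sum fun j _ => ?_)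
  rw [norm_smul, Real.norm_of_nonneg (hc j).le]
  refine mul_le_mul_of_nonneg_left ?_ (hc j).le
  refine (ContinuousLinearMap.opNorm_comp_le _ _).trans ?_
  have h1 : ‖(ContinuousLinearMap.proj j : (Fin N → H1 d) →L[ℝ] H1 d)‖ ≤ 1 :=
    ContinuousLinearMap.opNorm_le_bound _ zero_le_one fun Λ => by
      rw [one_mul]
      exact norm_le_pi_norm Λ j
  refine (mul_le_of_le_one_right (norm_nonneg _) h1).trans
    ((norm_curveFieldDeriv_le hα hβ _ hC).trans ?_)
  gcongr
  exact hM j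

lemma biMeas_residual (hK : ForwardAssumptions i Ks) (hf : StronglyMeas i f) (Γ : Fin N → H1 d) :
    BiMeas i (residual Ks f α β c Γ) :=
  (BiMeas.sum _ fun j _ => (biMeas_curveField hK (Γ j)).const_smul (c j)).sub hf.biMeas

lemma MemL2H.integrable_sq (hH : SamplingAssumptions i) (hf : MemL2H i f) :
    Integrable fun t => ‖f t‖ ^ 2 := by
  refine ⟨((hf.1.biMeas.norm hH).pow_const 2).aestronglyMeasurable, ?_⟩
  refine lt_of_le_of_lt (lintegral_mono fun t => ?_) hf.2
  rw [enorm_pow, enorm_norm]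

lemma MemL2H.integrable_norm (hH : SamplingAssumptions i) (hf : MemL2H i f) :
    Integrable fun t => ‖f t‖ := by
  refine Integrable.mono' ((hf.integrable_sq hH).add (integrable_const (1 : ℝ)))
    (hf.1.biMeas.norm hH).aestronglyMeasurable (ae_of_all _ fun t => ?_)
  rw [norm_norm]
  simp only [Pi.add_apply]
  nlinarith [sq_nonneg (‖f t‖ - 1), norm_nonneg (f t)]

lemma integrable_residual (hH : SamplingAssumptions i) (hK : ForwardAssumptions i Ks)
    (hf : MemL2H i f) (hα : 0 < α) (hβ : 0 < β) (hc : ∀ j, 0 < c j) (Γ : Fin N → H1 d) :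
    Integrable fun t => ‖residual Ks f α β c Γ t‖ := by
  obtain ⟨C, -, hC⟩ := hK.exists_bound
  refine Integrable.mono' ((integrable_const ((∑ j, c j) * (α⁻¹ * C))).add (hf.integrable_norm hH))
    ((biMeas_residual hK hf.1 Γ).norm hH).aestronglyMeasurable ?_
  filter_upwards [hC] with t ht
  rw [norm_norm]
  exact norm_residual_le hα hβ hc Γ ht

lemma integrable_residual_sq (hH : SamplingAssumptions i) (hK : ForwardAssumptions i Ks)
    (hf : MemL2H i f) (hα : 0 < α) (hβ : 0 < β) (hc : ∀ j, 0 < c j) (Γ : Fin N → H1 d) :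
    Integrable fun t => ‖residual Ks f α β c Γ t‖ ^ 2 := by
  obtain ⟨C, -, hC⟩ := hK.exists_bound
  refine Integrable.mono' ((integrable_const (2 * ((∑ j, c j) * (α⁻¹ * C)) ^ 2)).add
    ((hf.integrable_sq hH).const_mul 2))
    (((biMeas_residual hK hf.1 Γ).norm hH).pow_const 2).aestronglyMeasurable ?_
  filter_upwards [hC] with t ht
  have h := norm_residual_le (f := f) hα hβ hc Γ ht
  rw [norm_pow, norm_norm]
  simp only [Pi.add_apply]
  have h2 := pow_le_pow_left₀ (norm_nonneg _) h 2
  nlinarith [sq_nonneg ((∑ j, c j) * (α⁻¹ * C) - ‖f t‖)]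

/-- The integrand of the derivative of the fidelity term. -/
lemma inner_comp_residualDeriv (Γ : Fin N → H1 d) (t : unitInterval) (h : H t) :
    (innerSL ℝ h).comp (residualDeriv Ks α β c Γ t) = ∑ j, c j •
      ((innerSL ℝ h).comp (curveFieldDeriv Ks α β (Γ j) t)).comp (ContinuousLinearMap.proj j) := by
  ext Θ
  simp [residualDeriv]

lemma aestronglyMeasurable_inner_residualDeriv (hH : SamplingAssumptions i)
    (hK : ForwardAssumptions i Ks) (hΩ : IsOpen Ω) {g : ∀ t, H t} (hg : BiMeas i g)
    {Γ : Fin N → H1 d} (hΓ : ∀ j t, Γ j t ∈ Ω) :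
    AEStronglyMeasurable (fun t => (innerSL ℝ (g t)).comp (residualDeriv Ks α β c Γ t)) volume := by
  simp only [inner_comp_residualDeriv]
  refine Finset.aestronglyMeasurable_fun_sum _ fun j _ => AEStronglyMeasurable.fun_const_smul ?_ _
  exact ((ContinuousLinearMap.compL ℝ (Fin N → H1 d) (H1 d) ℝ).flip
    (ContinuousLinearMap.proj j)).continuous.comp_aestronglyMeasurable
    (aestronglyMeasurable_inner_curveFieldDeriv hH hK hΩ hg (hΓ j))

/-- Precomposition with a coordinate projection is continuous linear, so it commutes with the
integral; this splits the derivative into one term per curve. -/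
lemma integral_inner_residualDeriv_apply (hH : SamplingAssumptions i)
    (hK : ForwardAssumptions i Ks) (hΩ : IsOpen Ω) (hα : 0 < α) (hβ : 0 < β)
    {g : ∀ t, H t} (hg : BiMeas i g) (hgi : Integrable fun t => ‖g t‖)
    {Γ : Fin N → H1 d} (hΓ : ∀ j t, Γ j t ∈ Ω) (Θ : Fin N → H1 d) :
    (∫ t, (innerSL ℝ (g t)).comp (residualDeriv Ks α β c Γ t)) Θ = ∑ j, c j *
      (∫ t, (innerSL ℝ (g t)).comp (curveFieldDeriv Ks α β (Γ j) t)) (Θ j) := by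
  have hi := fun j => integrable_inner_curveFieldDeriv hH hK hΩ hα hβ hg hgi (hΓ j)
  let L : Fin N → (H1 d →L[ℝ] ℝ) →L[ℝ] ((Fin N → H1 d) →L[ℝ] ℝ) := fun j =>
    (ContinuousLinearMap.compL ℝ (Fin N → H1 d) (H1 d) ℝ).flip (ContinuousLinearMap.proj j)
  have e : ∫ t, (innerSL ℝ (g t)).comp (residualDeriv Ks α β c Γ t) = ∑ j, c j •
      L j (∫ t, (innerSL ℝ (g t)).comp (curveFieldDeriv Ks α β (Γ j) t)) := by
    have e0 : ∀ t, (innerSL ℝ (g t)).comp (residualDeriv Ks α β c Γ t)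
        = ∑ j, c j • L j ((innerSL ℝ (g t)).comp (curveFieldDeriv Ks α β (Γ j) t)) := fun t =>
      inner_comp_residualDeriv Γ t (g t)
    simp only [e0]
    rw [integral_finsetSum _ fun j _ => Integrable.fun_smul (c j) ((L j).integrable_comp (hi j))]
    refine Finset.sum_congr rfl fun j _ => ?_
    rw [← (L j).integral_comp_comm (hi j), ← integral_smul]
  rw [e]
  simp [L]

/-- The fidelity term is continuously differentiable along curves in `Ω`. -/
lemma fidelity_differentiable (hH : SamplingAssumptions i)
    (hK : ForwardAssumptions i Ks) (hf : MemL2H i f) (hΩ : IsOpen Ω) (hα : 0 < α) (hβ : 0 < β)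
    (hc : ∀ j, 0 < c j) {Γ : Fin N → H1 d} (hΓ : ∀ j t, Γ j t ∈ Ω) :
    ∃ s ∈ 𝓝 Γ, ContinuousOn (fun Λ : Fin N → H1 d => ∫ t,
        (innerSL ℝ (residual Ks f α β c Λ t)).comp (residualDeriv Ks α β c Λ t)) s ∧
      ∀ Λ ∈ s, HasFDerivAt (fun Λ : Fin N → H1 d => ∫ t, 1 / 2 * ‖residual Ks f α β c Λ t‖ ^ 2)
        (∫ t, (innerSL ℝ (residual Ks f α β c Λ t)).comp (residualDeriv Ks α β c Λ t)) Λ := by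
  obtain ⟨C, hC0, hC⟩ := hK.exists_bound
  have hMo : IsOpen {η : H1 d | ‖fderiv ℝ (weight α β) η‖ <
      ∑ j, ‖fderiv ℝ (weight α β) (Γ j)‖ + 1} := isOpen_lt
    ((contDiff_weight hα hβ).continuous_fderiv (by simp)).norm continuous_const
  -- One constant exceeding every component's weight derivative at `Γ`, so a single product
  -- neighbourhood and one dominating function serve both continuity and differentiability.
  set M := ∑ j, ‖fderiv ℝ (weight α β) (Γ j)‖ + 1 with hMdef
  let s : Set (Fin N → H1 d) := {Λ | ∀ j, Λ j ∈ {γ : H1 d | ∀ t, γ t ∈ Ω} ∩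
    {η : H1 d | ‖fderiv ℝ (weight α β) η‖ < M}}
  have hso : IsOpen s := by
    have : s = univ.pi fun _ => {γ : H1 d | ∀ t, γ t ∈ Ω} ∩
        {η : H1 d | ‖fderiv ℝ (weight α β) η‖ < M} := by
      ext Λ
      simp [s]
    rw [this]
    exact isOpen_set_pi finite_univ fun _ _ => (isOpen_forall_mem hΩ).inter hMo
  have hsΓ : Γ ∈ s := fun j => ⟨hΓ j, (Finset.single_le_sum
    (f := fun j => ‖fderiv ℝ (weight α β) (Γ j)‖) (fun _ _ => norm_nonneg _)
    (Finset.mem_univ j)).trans_lt (lt_add_one _)⟩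
  let bound : unitInterval → ℝ := fun t => ((∑ j, c j) * (α⁻¹ * C) + ‖f t‖) *
    ((∑ j, c j) * (α⁻¹ * (C * 2) + M * C))
  have hbi : Integrable bound :=
    ((integrable_const _).add (hf.integrable_norm hH)).mul_const _
  have hcs : 0 ≤ ∑ j, c j := Finset.sum_nonneg fun j _ => (hc j).le
  have hb : ∀ᵐ t, ∀ Λ ∈ s,
      ‖(innerSL ℝ (residual Ks f α β c Λ t)).comp (residualDeriv Ks α β c Λ t)‖ ≤ bound t := by
    filter_upwards [hC] with t ht Λ hΛ
    refine (ContinuousLinearMap.opNorm_comp_le _ _).trans ?_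
    rw [innerSL_apply_norm]
    exact mul_le_mul (norm_residual_le hα hβ hc Λ ht)
      (norm_residualDeriv_le hα hβ hc ht fun j => (hΛ j).2.le) (norm_nonneg _) (by positivity)
  have hm : ∀ Λ ∈ s, AEStronglyMeasurable (fun t =>
      (innerSL ℝ (residual Ks f α β c Λ t)).comp (residualDeriv Ks α β c Λ t)) volume := fun Λ hΛ =>
    aestronglyMeasurable_inner_residualDeriv hH hK hΩ (biMeas_residual hK hf.1 Λ)
      fun j => (hΛ j).1
  have hd : ∀ t, ∀ Λ ∈ s, HasFDerivAt (fun Λ => residual Ks f α β c Λ t)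
      (residualDeriv Ks α β c Λ t) Λ := fun t Λ hΛ =>
    hasFDerivAt_residual hΩ hα hβ fun j => (hΛ j).1 t
  refine ⟨s, hso.mem_nhds hsΓ, ?_, fun Λ hΛ => ?_⟩
  · refine continuousOn_of_dominated (bound := bound) hm (fun Λ hΛ => hb.mono fun t ht => ht Λ hΛ)
      hbi (ae_of_all _ fun t => ?_)
    refine ContinuousOn.clm_comp ?_ ?_
    · exact (innerSL ℝ).continuous.comp_continuousOn fun Λ hΛ =>
        (hd t Λ hΛ).continuousAt.continuousWithinAt
    · refine continuousOn_finsetSum _ fun j _ => ContinuousOn.fun_const_smul ?_ _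
      refine ContinuousOn.clm_comp ?_ continuousOn_const
      exact (continuousOn_curveFieldDeriv hΩ hα hβ t).comp (continuous_apply j).continuousOn
        fun Λ hΛ => (hΛ j).1 t
  · refine hasFDerivAt_integral_of_dominated_of_fderiv_le (bound := bound)
      (F' := fun Λ t => (innerSL ℝ (residual Ks f α β c Λ t)).comp (residualDeriv Ks α β c Λ t))
      (hso.mem_nhds hΛ) ?_ ?_ (hm Λ hΛ) hb hbi ?_
    · exact Eventually.of_forall fun Λ =>
        ((integrable_residual_sq hH hK hf hα hβ hc Λ).const_mul _).aestronglyMeasurable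
    · exact (integrable_residual_sq hH hK hf hα hβ hc Λ).const_mul _
    · refine ae_of_all _ fun t Θ hΘ => ?_
      -- The factor 2 from the squared norm cancels the one half.
      have h := ((hd t Θ hΘ).norm_sq).const_mul (1 / 2 : ℝ)
      refine h.congr_fderiv ?_
      rw [← Nat.cast_smul_eq_nsmul ℝ, smul_smul]
      norm_num

end TupleFields

/-! ### The sliding and insertion functionals in terms of the residual -/

section Functional

variable {d : ℕ} {Ω : Set (E d)} {N : ℕ}
  {H : unitInterval → Type*} [∀ t, NormedAddCommGroup (H t)] [∀ t, InnerProductSpace ℝ (H t)]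
  {D : Type*} [NormedAddCommGroup D] [NormedSpace ℝ D]
  {i : ∀ t, D →L[ℝ] H t} {Ks : ∀ t, StrongDual ℝ (C11 Ω) →L[ℝ] H t} {α β : ℝ}
  {f : ∀ t, H t} {c : Fin N → ℝ}

lemma residual_eq (Γ : Fin N → H1In Ω) (t : unitInterval) :
    residual Ks f α β c (fun j => (Γ j).1) t
      = (∑ j, (c j * weight α β (Γ j).1) • Ks t (diracDual ((Γ j).pos t))) - f t := by
  rw [residual]
  congr 1
  refine Finset.sum_congr rfl fun j _ => ?_
  rw [curveField, smul_smul, ← diracExt_coe]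
  rfl

lemma tikhonov_tupleMeasure (hH : SamplingAssumptions i) (hK : ForwardAssumptions i Ks)
    (hf : MemL2H i f) (hα : 0 < α) (hβ : 0 < β) (hc : ∀ j, 0 < c j) (Γ : Fin N → H1In Ω) :
    tikhonov Ks f α β (tupleMeasure α β c Γ) = ENNReal.ofReal
      ((∫ t, 1 / 2 * ‖residual Ks f α β c (fun j => (Γ j).1) t‖ ^ 2) + ∑ j, c j) := by
  have hi := integrable_residual_sq hH hK hf hα hβ hc fun j => (Γ j).1
  rw [ENNReal.ofReal_add (integral_nonneg fun _ => by positivity)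
    (Finset.sum_nonneg fun j _ => (hc j).le), tikhonov, regularizer_tupleMeasure hα hβ hc,
    fidelity_tupleMeasure Ks f hα hβ hc, integral_const_mul, ENNReal.ofReal_mul (by norm_num),
    ofReal_integral_eq_lintegral_ofReal hi (ae_of_all _ fun _ => by positivity)]
  congr 2
  · rw [ENNReal.ofReal_div_of_pos (by norm_num)]
    simp
  · refine lintegral_congr fun t => ?_
    rw [← residual_eq, ENNReal.ofReal_pow (norm_nonneg _), ofReal_norm]

lemma slidingFunctional_eq (hH : SamplingAssumptions i) (hK : ForwardAssumptions i Ks)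
    (hf : MemL2H i f) (hα : 0 < α) (hβ : 0 < β) (hc : ∀ j, 0 < c j) {Γ : Fin N → H1 d}
    (hΓ : ∀ j t, Γ j t ∈ closure Ω) :
    slidingFunctional Ks f α β c Γ
      = (∫ t, 1 / 2 * ‖residual Ks f α β c Γ t‖ ^ 2) + ∑ j, c j := by
  have h := tikhonov_tupleMeasure hH hK hf hα hβ hc fun j => (⟨Γ j, hΓ j⟩ : H1In Ω)
  rw [slidingFunctional, dif_pos hΓ]
  refine (congrArg ENNReal.toReal h).trans (ENNReal.toReal_ofReal ?_)
  exact add_nonneg (integral_nonneg fun _ => by positivity)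
    (Finset.sum_nonneg fun j _ => (hc j).le)

/-- The pre-adjoint identity tested on Dirac masses. The null set comes from weak continuity alone,
so it does not depend on `x` and moving points may be substituted. -/
lemma dualVariable_extZero (hK : ForwardAssumptions i Ks) (Γ : Fin N → H1In Ω) :
    ∀ᵐ t, ∀ x : E d, (dualVariable Ks f α β c Γ t).extZero x
      = -⟪residual Ks f α β c (fun j => (Γ j).1) t, Ks t (diracExt Ω x)⟫ := by
  filter_upwards [hK.weak_continuous] with t ht x
  rw [← diracExt_apply, dualVariable, map_neg, ← residual_eq, real_inner_comm,
    inner_eq_preadjoint ht]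

lemma integrable_dualVariable (hH : SamplingAssumptions i) (hK : ForwardAssumptions i Ks)
    (hf : MemL2H i f) (hα : 0 < α) (hβ : 0 < β) (hc : ∀ j, 0 < c j) (Γ : Fin N → H1In Ω)
    (γ : H1 d) : Integrable fun t => (dualVariable Ks f α β c Γ t).extZero (γ t) := by
  obtain ⟨C, -, hC⟩ := hK.exists_bound
  have h : Integrable fun t =>
      ⟪residual Ks f α β c (fun j => (Γ j).1) t, Ks t (diracExt Ω (γ t))⟫ := by
    refine Integrable.mono' ((integrable_residual hH hK hf hα hβ hc fun j => (Γ j).1).mul_const C)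
      ((biMeas_residual hK hf.1 _).inner hH
        (biMeas_diracExt hK γ.curve.continuous.measurable)).aestronglyMeasurable ?_
    filter_upwards [hC] with t ht
    refine (norm_inner_le_norm _ _).trans (mul_le_mul_of_nonneg_left ?_ (norm_nonneg _))
    exact ((Ks t).le_opNorm _).trans ((mul_le_of_le_one_right (norm_nonneg _)
      (norm_diracExt_le _)).trans ht)
  refine h.neg.congr ?_
  filter_upwards [dualVariable_extZero (f := f) (α := α) (β := β) (c := c) hK Γ] with t ht
  exact (ht (γ t)).symm

/-- The signs in the dual variable and in the dual work cancel. With the residual frozen at `Γ`, the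
functional depends on `γ` only through `curveField`, matching one term of the derivative of the
fidelity. -/
lemma insertionFunctional_eq (hK : ForwardAssumptions i Ks) (Γ : Fin N → H1In Ω) (γ : H1 d) :
    insertionFunctional α β (dualVariable Ks f α β c Γ) γ
      = ∫ t, ⟪residual Ks f α β c (fun j => (Γ j).1) t, curveField Ks α β γ t⟫ := by
  rw [insertionFunctional, dualWork, div_eq_inv_mul, ← integral_neg, ← integral_const_mul]
  refine integral_congr_ae ?_
  filter_upwards [dualVariable_extZero (f := f) (α := α) (β := β) (c := c) hK Γ] with t ht
  rw [ht, neg_neg, curveField, real_inner_smul_right, weight]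

end Functional

end DynamicInverse

end

open DynamicInverse

theorem mainTheorem11 {d : ℕ} (Ω : Set (E d)) (hΩ_open : IsOpen Ω)
    (hΩ_bdd : Bornology.IsBounded Ω)
    {H : unitInterval → Type*} [∀ t, NormedAddCommGroup (H t)] [∀ t, InnerProductSpace ℝ (H t)]
    [∀ t, CompleteSpace (H t)]
    {D : Type*} [NormedAddCommGroup D] [NormedSpace ℝ D] [CompleteSpace D]
    (i : ∀ t, D →L[ℝ] H t) (hH : SamplingAssumptions i)
    (Ks : ∀ t, StrongDual ℝ (C11 Ω) →L[ℝ] H t) (hK : ForwardAssumptions i Ks)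
    (f : ∀ t, H t) (hf : MemL2H i f) {α β : ℝ} (hα : 0 < α) (hβ : 0 < β)
    {N : ℕ} (c : Fin N → ℝ) (hc : ∀ j, 0 < c j) :
    (∀ Γ : Fin N → H1In Ω, tikhonov Ks f α β (tupleMeasure α β c Γ) < ⊤) ∧
    ∀ Γ : Fin N → H1In Ω, (∀ j t, (Γ j).1 t ∈ Ω) →
      ContDiffAt ℝ 1 (slidingFunctional (Ω := Ω) Ks f α β c) (fun j => (Γ j).1) ∧
      (∀ γ : H1In Ω, MeasureTheory.Integrable fun t =>
        (dualVariable Ks f α β c Γ t).extZero (γ.1 t)) ∧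
      (∀ j, DifferentiableAt ℝ (insertionFunctional α β (dualVariable Ks f α β c Γ)) (Γ j).1) ∧
      ∀ Θ : Fin N → H1 d,
        fderiv ℝ (slidingFunctional (Ω := Ω) Ks f α β c) (fun j => (Γ j).1) Θ =
          ∑ j, c j *
            fderiv ℝ (insertionFunctional α β (dualVariable Ks f α β c Γ)) (Γ j).1 (Θ j) := by
  refine ⟨fun Γ => ?_, fun Γ hΓ => ?_⟩
  · rw [tikhonov_tupleMeasure hH hK hf hα hβ hc]
    exact ENNReal.ofReal_lt_top
  obtain ⟨s, hs, hcont, hder⟩ :=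
    fidelity_differentiable hH hK hf hΩ_open hα hβ hc (Γ := fun j => (Γ j).1) hΓ
  have hopen : IsOpen {Λ : Fin N → H1 d | ∀ j t, Λ j t ∈ Ω} := by
    have e : {Λ : Fin N → H1 d | ∀ j t, Λ j t ∈ Ω} = univ.pi fun _ => {γ | ∀ t, γ t ∈ Ω} := by
      ext Λ
      simp
    rw [e]
    exact isOpen_set_pi finite_univ fun _ _ => isOpen_forall_mem hΩ_open
  -- The functional is set to 0 on tuples leaving the closure of `Ω`; near a tuple with values in
  -- the open set this default is never reached, so derivatives can be computed from the smooth
  -- formula.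
  have heq : ∀ Λ : Fin N → H1 d, (∀ j t, Λ j t ∈ Ω) →
      slidingFunctional (Ω := Ω) Ks f α β c =ᶠ[𝓝 Λ]
        fun Λ => (∫ t, 1 / 2 * ‖residual Ks f α β c Λ t‖ ^ 2) + ∑ j, c j := by
    intro Λ hΛ
    filter_upwards [hopen.mem_nhds hΛ] with Λ' hΛ'
    exact slidingFunctional_eq hH hK hf hα hβ hc fun j t => subset_closure (hΛ' j t)
  have hg := biMeas_residual (α := α) (β := β) (c := c) hK hf.1 fun j => (Γ j).1
  have hgi := integrable_residual hH hK hf hα hβ hc fun j => (Γ j).1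
  have hF : ∀ j, HasFDerivAt (insertionFunctional α β (dualVariable Ks f α β c Γ))
      (∫ t, (innerSL ℝ (residual Ks f α β c (fun j => (Γ j).1) t)).comp
        (curveFieldDeriv Ks α β (Γ j).1 t)) (Γ j).1 := by
    intro j
    have e : insertionFunctional α β (dualVariable Ks f α β c Γ) = fun γ =>
        ∫ t, ⟪residual Ks f α β c (fun j => (Γ j).1) t, curveField Ks α β γ t⟫ :=
      funext fun γ => insertionFunctional_eq hK Γ γ
    rw [e]
    exact hasFDerivAt_integral_inner_curveField hH hK hΩ_open hα hβ hg hgi (hΓ j)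
  refine ⟨?_, fun γ => integrable_dualVariable hH hK hf hα hβ hc Γ γ.1,
    fun j => (hF j).differentiableAt, fun Θ => ?_⟩
  · exact contDiffAt_one_iff.2 ⟨_, s ∩ {Λ | ∀ j t, Λ j t ∈ Ω},
      inter_mem hs (hopen.mem_nhds hΓ), hcont.mono inter_subset_left, fun Λ hΛ =>
      ((hder Λ hΛ.1).add_const _).congr_of_eventuallyEq (heq Λ hΛ.2)⟩
  -- The constant `∑ c_j` drops out, and both sides become the same weighted sum of integrals.
  · rw [(((hder _ (mem_of_mem_nhds hs)).add_const _).congr_of_eventuallyEq (heq _ hΓ)).fderiv,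
      integral_inner_residualDeriv_apply hH hK hΩ_open hα hβ hg hgi hΓ]
    refine Finset.sum_congr rfl fun j _ => ?_
    rw [(hF j).fderiv]
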